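/- **Definitions.** Let $\mathbb T$ be the unit circle bounding the open unit disk $\mathbb D\subset\mathbb C$. A *leaf* is a chord $\overline{ab}$ with $a,b\in\mathbb T$ (degenerate if $a=b$). A *geometric lamination* $\mathcal L$ is a compact set of leaves such that any two distinct leaves meet at most in an endpoint of both. Put $\mathcal L^*=\mathbb T\cup\bigcup\mathcal L$. We say that $\mathcal L$ *has dense gaps* if $\mathbb D\setminus\mathcal L^*$ is dense in $\mathbb D$. It is *invariant* if, with $\sigma(z)=z^2$, for every $\overline{cd}\in\mathcal L$ the chord $\overline{\sigma(c)\sigma(d)}$ is in $\mathcal L$ and there are two disjoint leaves $\overline{c'd'},\overline{c''d''}\in\mathcal L$ with $\sigma(c')=\sigma(c'')=c$ and $\sigma(d')=\sigma(d'')=d$. An equivalence relation on $\mathbb T$ is *closed* if its graph is closed in $\mathbb T\times\mathbb T$; its classes are *pairwise unlinked* if distinct classes have disjoint convex hulls; it is *degenerate* if it identifies all points of $\mathbb T$. A *lamination* is a closed equivalence relation on $\mathbb T$ with pairwise unlinked classes which either has nowhere dense classes or is degenerate. A relation $R$ on $\mathbb T$ is *compatible* with $\mathcal L$ if $\overline{xy}\in\mathcal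 L$ implies $xRy$; $R$ is *finer* than $Q$ if $xRy$ implies $xQy$. A *continuum* is a nonempty compact connected set (possibly a single point). For $x,y\in\mathbb T$ write $x\sim_{\mathcal L}y$ if there is a continuum $K\subset\mathcal L^*$ containing $x$ and $y$ such that $K\cap\mathbb T$ is countable. **Theorem.** Let $\mathcal L$ be a geometric lamination with dense gaps. 1. $\sim_{\mathcal L}$ is a closed equivalence relation on $\mathbb T$ whose classes are pairwise unlinked. 2. $\sim_{\mathcal L}$ is compatible with $\mathcal L$ and is finer than every closed equivalence relation compatible with $\mathcal L$; that is, $\sim_{\mathcal L}$ is the finest closed equivalence relation compatible with $\mathcal L$, the intersection of all of them. 3. If $\mathcal L$ is invariant, or if some non-degenerate lamination is compatible with $\mathcal L$, then $\sim_{\mathcal L}$ is a lamination, and it equals the intersection $R_{\mathcal L}$ of all laminations compatible with $\mathcal L$. -/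

import Mathlib

/-- The (possibly degenerate) chord of the unit disk joining two points of the unit circle. -/
def chord (a b : Circle) : Set ℂ := segment ℝ (a : ℂ) (b : ℂ)

/-- A geometric lamination: a compact set of leaves (chords of the unit circle, possibly
degenerate) such that two distinct leaves meet at most in an endpoint of both of them.
A leaf is recorded by the ordered pairs of its endpoints, so the set of pairs is symmetric. -/
structure GeometricLamination where
  leaves : Set (Circle × Circle)
  symm : ∀ a b, (a, b) ∈ leaves → (b, a) ∈ leaves
  isCompact : IsCompact leaves
  meet : ∀ a b c d, (a, b) ∈ leaves → (c, d) ∈ leaves → s(a, b) ≠ s(c, d) →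
    chord a b ∩ chord c d ⊆ ({(a : ℂ), (b : ℂ)} ∩ {(c : ℂ), (d : ℂ)} : Set ℂ)

/-- The equivalence class of `x`. -/
def relClass (r : Circle → Circle → Prop) (x : Circle) : Set Circle := {z | r x z}

/-- The convex hull in the plane of a subset of the unit circle. -/
def circleHull (A : Set Circle) : Set ℂ := convexHull ℝ ((fun z : Circle => (z : ℂ)) '' A)

/-- An equivalence relation on the circle whose graph is closed. -/
structure IsClosedEquivalence (r : Circle → Circle → Prop) : Prop where
  equivalence : Equivalence r
  isClosed : IsClosed {p : Circle × Circle | r p.1 p.2}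

/-- Distinct classes have disjoint convex hulls. -/
def HasUnlinkedClasses (r : Circle → Circle → Prop) : Prop :=
  ∀ x y, ¬ r x y → Disjoint (circleHull (relClass r x)) (circleHull (relClass r y))

/-- The relation that identifies all points of the circle. -/
def IsDegenerate (r : Circle → Circle → Prop) : Prop := ∀ x y, r x y

/-- A lamination: a closed equivalence relation on the circle with pairwise unlinked, nowhere
dense classes; the degenerate relation is counted as a lamination too. -/
structure IsLamination (r : Circle → Circle → Prop) : Prop where
  closedEquivalence : IsClosedEquivalence r
  unlinked : HasUnlinkedClasses r
  nowhereDense : (∀ x, IsNowhereDense (relClass r x)) ∨ IsDegenerate r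

namespace GeometricLamination

/-- The union of the unit circle and of all the leaves. -/
def star (L : GeometricLamination) : Set ℂ :=
  Metric.sphere (0 : ℂ) 1 ∪ ⋃ p ∈ L.leaves, chord p.1 p.2

/-- The gaps are the closures of the components of the open disk minus `L.star`; they are dense
when the open disk minus `L.star` is dense in the disk. -/
def HasDenseGaps (L : GeometricLamination) : Prop :=
  Metric.ball (0 : ℂ) 1 ⊆ closure (Metric.ball (0 : ℂ) 1 \ L.star)

/-- Invariance under the doubling map of the circle, which is squaring of unit complex numbers. -/
def IsInvariant (L : GeometricLamination) : Prop :=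
  ∀ c d, (c, d) ∈ L.leaves →
    (c ^ 2, d ^ 2) ∈ L.leaves ∧
    ∃ c₁ d₁ c₂ d₂, (c₁, d₁) ∈ L.leaves ∧ (c₂, d₂) ∈ L.leaves ∧
      Disjoint (chord c₁ d₁) (chord c₂ d₂) ∧
      c₁ ^ 2 = c ∧ c₂ ^ 2 = c ∧ d₁ ^ 2 = d ∧ d₂ ^ 2 = d

/-- A continuum (nonempty, compact, connected; possibly one point) in `L.star` that meets the
unit circle in a countable set. -/
structure IsOmegaContinuum (L : GeometricLamination) (K : Set ℂ) : Prop where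
  subset_star : K ⊆ L.star
  isCompact : IsCompact K
  isConnected : IsConnected K
  countable : (K ∩ Metric.sphere (0 : ℂ) 1).Countable

/-- The relation induced by `L` on the circle. -/
def sim (L : GeometricLamination) (x y : Circle) : Prop :=
  ∃ K : Set ℂ, L.IsOmegaContinuum K ∧ (x : ℂ) ∈ K ∧ (y : ℂ) ∈ K

/-- The endpoints of every leaf are related. -/
def Compatible (L : GeometricLamination) (r : Circle → Circle → Prop) : Prop :=
  ∀ x y, (x, y) ∈ L.leaves → r x y

/-- `r` is the finest closed equivalence relation compatible with `L`. -/
structure IsFinestCompatible (L : GeometricLamination) (r : Circle → Circle → Prop) : Prop where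
  closedEquivalence : IsClosedEquivalence r
  compatible : L.Compatible r
  finest : ∀ q : Circle → Circle → Prop, IsClosedEquivalence q → L.Compatible q →
    ∀ x y, r x y → q x y

/-- The intersection of all closed equivalence relations compatible with `L`. -/
def closedRel (L : GeometricLamination) (x y : Circle) : Prop :=
  ∀ r : Circle → Circle → Prop, IsClosedEquivalence r → L.Compatible r → r x y

/-- The intersection of all laminations (the degenerate one included) compatible with `L`. -/
def laminationRel (L : GeometricLamination) (x y : Circle) : Prop :=
  ∀ r : Circle → Circle → Prop, IsLamination r → L.Compatible r → r x y

end GeometricLamination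

/-! For a geometric lamination `L` whose gaps are dense, the relation `L.sim` given by continua in
`L.star` with countable trace on the circle is the finest closed equivalence relation that
identifies the endpoints of leaves.

Every point of `L.star` in the open disk lies on a leaf, and a leaf that meets an omega-continuum
can be added to it. Hence an omega-continuum which crosses a chord provides a related leaf that
crosses the chord (`sim_cases_of_arcSide`). Since leaves do not cross, linked pairs of related
points are related to each other (`sim_of_linked`), and this gives disjoint convex hulls
(`hasUnlinkedClasses_sim`).

A class is closed (`sim_of_mem_closure`). Let points of the class of `c` converge to `x` from one
side. If leaves between points of the class, all over one fixed point, have ends that accumulate at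
`x`, they are nested and converge to a leaf at `x` (or to `x` itself); the omega-continua that join
consecutive leaves are cut down to the strips between them and accumulate only on the limit leaf.
Otherwise there are points of the class converging to `x` that are not under any such leaf, and an
omega-continuum joining two of them remains connected when it is cut off at the first one. In both
cases the pieces and their limit form an omega-continuum (`IsOmegaContinuum.union_iUnion`) that
joins `x` to the class.

The graph of `sim` is closed (`isClosed_sim`). If related pairs lying in infinitely many classes
converge to `(x, y)`, the classes cannot have a third limit point, by unlinkedness
(`exists_sim_of_tendsto_three`). The omega-continua cross the perpendicular bisector of the chord
from `x` to `y`, and the leaves on which they do so can only converge to this chord, which is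
therefore a leaf.

Dense gaps enter only in `IsOmegaContinuum.endpoint_mem`: an omega-continuum with a point on the
circle contains an endpoint of each leaf that it meets, because gaps close to the leaf would
otherwise disconnect it. A continuous function on the circle which is constant on leaves therefore
takes on the countable trace of an omega-continuum all the values between any two of its values
there, and so it is constant on this trace. Closed equivalence relations on a compact Hausdorff
space are separated by continuous functions, so `sim` is finer than each compatible one
(`sim_le_of_compatible`).

For invariant `L`, the pullback of `sim` under the doubling map is compatible, hence doubling
preserves `sim`, and a class with interior is blown up to the whole circle
(`isNowhereDense_or_isDegenerate`). -/

open Filter Topology Set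

/-! ### Chords and the sides of a chord -/

/-- The signed distance of `w` to the line through `exp (i α)` and `exp (i β)`, positive on the side
of the arc from `α` to `β`. For `α = β` and for `β = α + 2π` the line is the tangent at `exp (i α)`,
so the formula makes sense for degenerate chords too. -/
noncomputable def arcSide (α β : ℝ) (w : ℂ) : ℝ :=
  w.re * Real.cos ((α + β) / 2) + w.im * Real.sin ((α + β) / 2) - Real.cos ((β - α) / 2)

theorem Circle.exp_re (γ : ℝ) : ((Circle.exp γ : Circle) : ℂ).re = Real.cos γ := by
  rw [Circle.coe_exp, Complex.exp_ofReal_mul_I_re]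

theorem Circle.exp_im (γ : ℝ) : ((Circle.exp γ : Circle) : ℂ).im = Real.sin γ := by
  rw [Circle.coe_exp, Complex.exp_ofReal_mul_I_im]

theorem continuous_arcSide : Continuous fun p : ℝ × ℝ × ℂ => arcSide p.1 p.2.1 p.2.2 := by
  unfold arcSide
  fun_prop

theorem continuous_arcSide_right (α β : ℝ) : Continuous (arcSide α β) := by
  unfold arcSide
  fun_prop

theorem arcSide_exp (α β γ : ℝ) :
    arcSide α β (Circle.exp γ) = 2 * Real.sin ((γ - α) / 2) * Real.sin ((β - γ) / 2) := by
  rw [arcSide, Circle.exp_re, Circle.exp_im, Real.two_mul_sin_mul_sin,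
    show (γ - α) / 2 - (β - γ) / 2 = γ - (α + β) / 2 by ring,
    show (γ - α) / 2 + (β - γ) / 2 = (β - α) / 2 by ring, Real.cos_sub]

theorem arcSide_exp_left (α β : ℝ) : arcSide α β (Circle.exp α) = 0 := by
  rw [arcSide_exp]; simp

theorem arcSide_exp_right (α β : ℝ) : arcSide α β (Circle.exp β) = 0 := by
  rw [arcSide_exp]; simp

theorem arcSide_exp_pos {α β γ : ℝ} (h₁ : α < γ) (h₂ : γ < β) (h : β ≤ α + 2 * Real.pi) :
    0 < arcSide α β (Circle.exp γ) := by
  rw [arcSide_exp]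
  have := Real.sin_pos_of_pos_of_lt_pi (x := (γ - α) / 2) (by linarith) (by linarith)
  have := Real.sin_pos_of_pos_of_lt_pi (x := (β - γ) / 2) (by linarith) (by linarith)
  positivity

theorem arcSide_exp_nonneg {α β γ : ℝ} (h₁ : α ≤ γ) (h₂ : γ ≤ β) (h : β ≤ α + 2 * Real.pi) :
    0 ≤ arcSide α β (Circle.exp γ) := by
  rw [arcSide_exp]
  have := Real.sin_nonneg_of_nonneg_of_le_pi (x := (γ - α) / 2) (by linarith) (by linarith)
  have := Real.sin_nonneg_of_nonneg_of_le_pi (x := (β - γ) / 2) (by linarith) (by linarith)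
  positivity

theorem arcSide_exp_neg {α β γ : ℝ} (hαβ : α ≤ β) (h₁ : β < γ) (h₂ : γ < α + 2 * Real.pi) :
    arcSide α β (Circle.exp γ) < 0 := by
  rw [arcSide_exp]
  have := Real.sin_pos_of_pos_of_lt_pi (x := (γ - α) / 2) (by linarith) (by linarith)
  have := Real.sin_neg_of_neg_of_neg_pi_lt (x := (β - γ) / 2) (by linarith) (by linarith)
  nlinarith

theorem arcSide_exp_nonpos {α β γ : ℝ} (hαβ : α ≤ β) (h₁ : β ≤ γ) (h₂ : γ ≤ α + 2 * Real.pi) :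
    arcSide α β (Circle.exp γ) ≤ 0 := by
  rw [arcSide_exp]
  have := Real.sin_nonneg_of_nonneg_of_le_pi (x := (γ - α) / 2) (by linarith) (by linarith)
  have := Real.sin_nonpos_of_nonpos_of_neg_pi_le (x := (β - γ) / 2) (by linarith) (by linarith)
  nlinarith

theorem Circle.exists_exp_eq (α : ℝ) (z : Circle) :
    ∃ γ, α ≤ γ ∧ γ < α + 2 * Real.pi ∧ Circle.exp γ = z := by
  obtain ⟨t, rfl⟩ := Circle.exp_surjective z
  obtain ⟨γ, hγ, h⟩ := Circle.periodic_exp.exists_mem_Ico Real.two_pi_pos t α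
  exact ⟨γ, hγ.1, hγ.2, h.symm⟩

theorem exists_exp_of_arcSide_pos {α β : ℝ} (hαβ : α ≤ β) {z : Circle}
    (hz : 0 < arcSide α β z) : ∃ γ, α < γ ∧ γ < β ∧ Circle.exp γ = z := by
  obtain ⟨γ, h₁, h₂, rfl⟩ := Circle.exists_exp_eq α z
  refine ⟨γ, lt_of_le_of_ne h₁ ?_, ?_, rfl⟩
  · rintro rfl
    exact hz.ne' (arcSide_exp_left α β)
  · by_contra! h₃
    exact absurd (arcSide_exp_nonpos hαβ h₃ h₂.le) (not_le.2 hz)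

theorem exists_exp_of_arcSide_neg {α β : ℝ} (h : β ≤ α + 2 * Real.pi) {z : Circle}
    (hz : arcSide α β z < 0) : ∃ γ, β < γ ∧ γ < α + 2 * Real.pi ∧ Circle.exp γ = z := by
  obtain ⟨γ, h₁, h₂, rfl⟩ := Circle.exists_exp_eq α z
  refine ⟨γ, ?_, h₂, rfl⟩
  by_contra! h₃
  exact absurd (arcSide_exp_nonneg h₁ h₃ h) (not_le.2 hz)

theorem exists_exp_of_arcSide_nonneg {α β : ℝ} (hαβ : α ≤ β) {z : Circle}
    (hz : 0 ≤ arcSide α β z) : ∃ γ, α ≤ γ ∧ γ ≤ β ∧ Circle.exp γ = z := by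
  obtain ⟨γ, h₁, h₂, rfl⟩ := Circle.exists_exp_eq α z
  refine ⟨γ, h₁, ?_, rfl⟩
  by_contra! h₃
  exact absurd (arcSide_exp_neg hαβ h₃ h₂) (not_lt.2 hz)

theorem arcSide_add_smul (α β t s : ℝ) (h : t + s = 1) (z w : ℂ) :
    arcSide α β (t • z + s • w) = t * arcSide α β z + s * arcSide α β w := by
  obtain rfl : s = 1 - t := by linarith
  simp [arcSide]
  ring

theorem convex_arcSide_nonneg (α β : ℝ) : Convex ℝ {w | 0 ≤ arcSide α β w} := by
  intro z hz w hw t s ht hs h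
  simp only [mem_ofPred_eq] at *
  rw [arcSide_add_smul α β t s h]
  positivity

theorem convex_arcSide_neg (α β : ℝ) : Convex ℝ {w | arcSide α β w < 0} := by
  intro z hz w hw t s ht hs h
  simp only [mem_ofPred_eq] at *
  rw [arcSide_add_smul α β t s h]
  rcases ht.eq_or_lt with rfl | ht
  · obtain rfl : s = 1 := by linarith
    simpa using hw
  · nlinarith

theorem convex_arcSide_nonpos (α β : ℝ) : Convex ℝ {w | arcSide α β w ≤ 0} := by
  intro z hz w hw t s ht hs h
  simp only [mem_ofPred_eq] at *
  rw [arcSide_add_smul α β t s h]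
  nlinarith

theorem isClosed_arcSide_nonneg (α β : ℝ) : IsClosed {w | 0 ≤ arcSide α β w} :=
  isClosed_le continuous_const (continuous_arcSide_right α β)

theorem isClosed_arcSide_nonpos (α β : ℝ) : IsClosed {w | arcSide α β w ≤ 0} :=
  isClosed_le (continuous_arcSide_right α β) continuous_const

theorem chord_comm (a b : Circle) : chord a b = chord b a := segment_symm ℝ _ _

theorem left_mem_chord (a b : Circle) : (a : ℂ) ∈ chord a b := left_mem_segment ℝ _ _

theorem right_mem_chord (a b : Circle) : (b : ℂ) ∈ chord a b := right_mem_segment ℝ _ _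

theorem chord_self (a : Circle) : chord a a = {(a : ℂ)} := segment_same ℝ _

theorem isCompact_chord (a b : Circle) : IsCompact (chord a b) := by
  rw [chord, segment_eq_image_lineMap]
  exact isCompact_Icc.image AffineMap.lineMap_continuous

theorem isConnected_chord (a b : Circle) : IsConnected (chord a b) :=
  ⟨⟨_, left_mem_chord a b⟩, (convex_segment _ _).isPreconnected⟩

theorem chord_subset_closedBall (a b : Circle) : chord a b ⊆ Metric.closedBall 0 1 :=
  (convex_closedBall _ _).segment_subset
    (by simp [Circle.norm_coe]) (by simp [Circle.norm_coe])

theorem Circle.coe_mem_sphere (a : Circle) : (a : ℂ) ∈ Metric.sphere (0 : ℂ) 1 := by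
  simp [Circle.norm_coe]

theorem exists_coe_circle {w : ℂ} (hw : w ∈ Metric.sphere (0 : ℂ) 1) : ∃ z : Circle, (z : ℂ) = w :=
  ⟨⟨w, hw⟩, rfl⟩

/-- The line through two points of the circle meets the closed disk in their chord. -/
theorem mem_chord_of_arcSide_eq_zero {α β : ℝ} (h₁ : α ≤ β) (h₂ : β ≤ α + 2 * Real.pi) {w : ℂ}
    (hw : w ∈ Metric.closedBall (0 : ℂ) 1) (h : arcSide α β w = 0) :
    w ∈ chord (Circle.exp α) (Circle.exp β) := by
  obtain ⟨m, hm⟩ : ∃ m, m = (α + β) / 2 := ⟨_, rfl⟩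
  obtain ⟨d, hd⟩ : ∃ d, d = (β - α) / 2 := ⟨_, rfl⟩
  obtain rfl : α = m - d := by linarith
  obtain rfl : β = m + d := by linarith
  clear hm hd
  have hu : w.re * Real.cos m + w.im * Real.sin m = Real.cos d := by
    have := h
    rw [arcSide] at this
    ring_nf at this
    linarith
  have hn : w.re ^ 2 + w.im ^ 2 ≤ 1 := by
    have h1 : ‖w‖ ≤ 1 := by simpa using hw
    have h2 : ‖w‖ ^ 2 ≤ 1 := by nlinarith [norm_nonneg w]
    rw [← Complex.normSq_eq_norm_sq, Complex.normSq_apply] at h2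
    linarith
  have hs0 : 0 ≤ Real.sin d := Real.sin_nonneg_of_nonneg_of_le_pi (by linarith) (by linarith)
  set v := -w.re * Real.sin m + w.im * Real.cos m with hv
  have hcm := Real.sin_sq_add_cos_sq m
  have hcd := Real.sin_sq_add_cos_sq d
  have hre : w.re = Real.cos d * Real.cos m - v * Real.sin m := by
    rw [← hu, hv]; linear_combination (-w.re) * hcm
  have him : w.im = Real.cos d * Real.sin m + v * Real.cos m := by
    rw [← hu, hv]; linear_combination (-w.im) * hcm
  have hvs : v ^ 2 ≤ Real.sin d ^ 2 := by
    have : v ^ 2 + Real.cos d ^ 2 = w.re ^ 2 + w.im ^ 2 := by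
      rw [← hu, hv]; linear_combination (w.re ^ 2 + w.im ^ 2) * hcm
    linarith
  obtain ⟨hv1, hv2⟩ := abs_le_of_sq_le_sq' hvs hs0
  rw [chord, segment_eq_image]
  rcases hs0.eq_or_lt with hs | hs
  · refine ⟨0, by simp, ?_⟩
    have hv0 : v = 0 := by rw [← hs] at hv1 hv2; linarith
    apply Complex.ext
    · rw [Complex.add_re, Complex.smul_re, Complex.smul_re, Circle.exp_re, Circle.exp_re,
        Real.cos_sub, hre, hv0, ← hs]
      simp [mul_comm]
    · rw [Complex.add_im, Complex.smul_im, Complex.smul_im, Circle.exp_im, Circle.exp_im,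
        Real.sin_sub, him, hv0, ← hs]
      simp [mul_comm]
  · have hne := hs.ne'
    refine ⟨(v + Real.sin d) / (2 * Real.sin d), ⟨by apply div_nonneg <;> linarith,
      by rw [div_le_one (by linarith)]; linarith⟩, ?_⟩
    apply Complex.ext
    · rw [Complex.add_re, Complex.smul_re, Complex.smul_re, Circle.exp_re, Circle.exp_re,
        Real.cos_sub, Real.cos_add, hre, smul_eq_mul, smul_eq_mul]
      field_simp
      ring
    · rw [Complex.add_im, Complex.smul_im, Complex.smul_im, Circle.exp_im, Circle.exp_im,
        Real.sin_sub, Real.sin_add, him, smul_eq_mul, smul_eq_mul]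
      field_simp
      ring

theorem arcSide_eq_zero_of_mem_chord {α β : ℝ} {w : ℂ}
    (h : w ∈ chord (Circle.exp α) (Circle.exp β)) : arcSide α β w = 0 := by
  obtain ⟨t, s, -, -, hts, rfl⟩ := h
  rw [arcSide_add_smul α β t s hts, arcSide_exp_left, arcSide_exp_right]
  simp

/-- A chord meets the circle only in its endpoints. -/
theorem eq_or_eq_of_coe_mem_chord {a b z : Circle} (h : (z : ℂ) ∈ chord a b) : z = a ∨ z = b := by
  obtain ⟨α, rfl⟩ := Circle.exp_surjective a
  obtain ⟨β, h₁, h₂, rfl⟩ := Circle.exists_exp_eq α b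
  have h0 := arcSide_eq_zero_of_mem_chord h
  by_contra! hne
  rcases lt_trichotomy (arcSide α β z) 0 with hz | hz | hz
  · exact hz.ne h0
  · obtain ⟨γ, h₃, h₄, rfl⟩ := exists_exp_of_arcSide_nonneg h₁ h0.ge
    exact (arcSide_exp_pos (lt_of_le_of_ne h₃ fun h => hne.1 (h ▸ rfl))
      (lt_of_le_of_ne h₄ fun h => hne.2 (h ▸ rfl)) h₂.le).ne' h0
  · exact hz.ne' h0

theorem chord_inter_sphere (a b : Circle) :
    chord a b ∩ Metric.sphere 0 1 ⊆ {(a : ℂ), (b : ℂ)} := by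
  rintro w ⟨hw, hs⟩
  obtain ⟨z, rfl⟩ := exists_coe_circle hs
  rcases eq_or_eq_of_coe_mem_chord hw with rfl | rfl <;> simp

/-- A neighbourhood of `t` in `ℝ` is mapped to a neighbourhood of `exp (i t)` in the circle. -/
theorem Circle.image_exp_mem_nhds {t : ℝ} {U : Set ℝ} (hU : U ∈ 𝓝 t) :
    Circle.exp '' U ∈ 𝓝 (Circle.exp t) :=
  isLocalHomeomorph_circleExp.isOpenMap.image_mem_nhds hU

/-- If a connected closed set is cut in two by a level set which meets it in a connected set,
then each of the two parts is connected. -/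
theorem IsConnected.inter_nonneg {X : Set ℂ} (hX : IsConnected X) (hXc : IsClosed X) {f : ℂ → ℝ}
    (hf : Continuous f) (h0 : IsConnected (X ∩ {w | f w = 0})) :
    IsConnected (X ∩ {w | 0 ≤ f w}) := by
  have hsub : X ∩ {w | f w = 0} ⊆ X ∩ {w | 0 ≤ f w} :=
    inter_subset_inter_right _ fun w (hw : f w = 0) => hw.ge
  refine ⟨h0.1.mono hsub, ?_⟩
  have hn : IsClosed {w | f w ≤ 0} := isClosed_le hf continuous_const
  have hp : IsClosed {w | 0 ≤ f w} := isClosed_le continuous_const hf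
  have key : ∀ t t' : Set ℂ, IsClosed t → IsClosed t' → X ∩ {w | 0 ≤ f w} ⊆ t ∪ t' →
      (X ∩ {w | 0 ≤ f w} ∩ t).Nonempty → (X ∩ {w | 0 ≤ f w} ∩ t').Nonempty →
      X ∩ {w | f w = 0} ⊆ t → (X ∩ {w | 0 ≤ f w} ∩ (t ∩ t')).Nonempty := by
    intro t t' ht ht' hcov h1 h2 h3
    obtain ⟨w, hwX, hw⟩ := isPreconnected_closed_iff.1 hX.2
      ((t ∩ {w | 0 ≤ f w}) ∪ (X ∩ {w | f w ≤ 0})) (t' ∩ {w | 0 ≤ f w})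
      ((ht.inter hp).union (hXc.inter hn)) (ht'.inter hp)
      (by
        intro w hw
        rcases le_total 0 (f w) with h | h
        · rcases hcov ⟨hw, h⟩ with h' | h'
          · exact Or.inl (Or.inl ⟨h', h⟩)
          · exact Or.inr ⟨h', h⟩
        · exact Or.inl (Or.inr ⟨hw, h⟩))
      (by obtain ⟨w, ⟨hw, h⟩, h'⟩ := h1; exact ⟨w, hw, Or.inl ⟨h', h⟩⟩)
      (by obtain ⟨w, ⟨hw, h⟩, h'⟩ := h2; exact ⟨w, hw, h', h⟩)
    rcases hw with ⟨h | h, h', h''⟩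
    · exact ⟨w, ⟨hwX, h''⟩, h.1, h'⟩
    · exact ⟨w, ⟨hwX, h''⟩, h3 ⟨hwX, le_antisymm h.2 h''⟩, h'⟩
  rw [isPreconnected_closed_iff]
  intro t t' ht ht' hcov h1 h2
  -- the connected level set lies in one of the two closed pieces, unless they meet on it
  by_cases hz : (X ∩ {w | f w = 0} ∩ (t ∩ t')).Nonempty
  · exact hz.mono (inter_subset_inter_left _ hsub)
  · have hz1 : X ∩ {w | f w = 0} ⊆ t ∨ X ∩ {w | f w = 0} ⊆ t' := by
      by_contra! hcon
      obtain ⟨⟨u, hu, hu'⟩, v, hv, hv'⟩ :=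
        And.intro (not_subset.1 hcon.1) (not_subset.1 hcon.2)
      exact hz (isPreconnected_closed_iff.1 h0.2 t t' ht ht' (hsub.trans hcov)
        ⟨v, hv, (hcov (hsub hv)).resolve_right hv'⟩ ⟨u, hu, (hcov (hsub hu)).resolve_left hu'⟩)
    rcases hz1 with h3 | h3
    · exact key t t' ht ht' hcov h1 h2 h3
    · rw [inter_comm t t']
      exact key t' t ht' ht (union_comm t t' ▸ hcov) h2 h1 h3

theorem IsConnected.inter_nonpos {X : Set ℂ} (hX : IsConnected X) (hXc : IsClosed X) {f : ℂ → ℝ}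
    (hf : Continuous f) (h0 : IsConnected (X ∩ {w | f w = 0})) :
    IsConnected (X ∩ {w | f w ≤ 0}) := by
  have := hX.inter_nonneg hXc hf.neg (by simpa using h0)
  simpa using this

namespace GeometricLamination

/-! ### Leaves through the points of `star` -/

/-- The leaves together with the degenerate leaves at all points of the circle. Their chords
cover `L.star`, so that points on the circle need no separate treatment. -/
def fullLeaves (L : GeometricLamination) : Set (Circle × Circle) :=
  L.leaves ∪ {p | p.1 = p.2}

theorem isCompact_fullLeaves (L : GeometricLamination) : IsCompact L.fullLeaves :=
  L.isCompact.union (isClosed_eq continuous_fst continuous_snd).isCompact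

theorem mem_fullLeaves_self (L : GeometricLamination) (a : Circle) : (a, a) ∈ L.fullLeaves :=
  Or.inr rfl

theorem mem_leaves_of_ne {L : GeometricLamination} {a b : Circle} (h : (a, b) ∈ L.fullLeaves)
    (hab : a ≠ b) : (a, b) ∈ L.leaves := h.resolve_right hab

theorem fullLeaves_symm {L : GeometricLamination} {a b : Circle} (h : (a, b) ∈ L.fullLeaves) :
    (b, a) ∈ L.fullLeaves :=
  h.imp (L.symm a b) fun h => Eq.symm h

theorem chord_subset_star {L : GeometricLamination} {a b : Circle} (h : (a, b) ∈ L.fullLeaves) :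
    chord a b ⊆ L.star := by
  rcases h with h | h
  · exact (subset_biUnion_of_mem (u := fun p : Circle × Circle => chord p.1 p.2) h).trans
      subset_union_right
  · obtain rfl : a = b := h
    rw [chord_self, singleton_subset_iff]
    exact Or.inl a.coe_mem_sphere

theorem exists_mem_chord {L : GeometricLamination} {w : ℂ} (h : w ∈ L.star) :
    ∃ a b, (a, b) ∈ L.fullLeaves ∧ w ∈ chord a b := by
  rcases h with h | h
  · obtain ⟨z, rfl⟩ := exists_coe_circle h
    exact ⟨z, z, L.mem_fullLeaves_self z, left_mem_chord z z⟩
  · simp only [mem_iUnion] at h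
    obtain ⟨⟨a, b⟩, hab, h⟩ := h
    exact ⟨a, b, Or.inl hab, h⟩

theorem star_subset_closedBall (L : GeometricLamination) : L.star ⊆ Metric.closedBall 0 1 := by
  intro w hw
  obtain ⟨a, b, -, h⟩ := exists_mem_chord hw
  exact chord_subset_closedBall a b h

theorem meet_fullLeaves {L : GeometricLamination} {a b c d : Circle} (h : (a, b) ∈ L.fullLeaves)
    (h' : (c, d) ∈ L.fullLeaves) (hne : s(a, b) ≠ s(c, d)) {w : ℂ} (hw : w ∈ chord a b)
    (hw' : w ∈ chord c d) : (w = a ∨ w = b) ∧ (w = c ∨ w = d) := by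
  rcases h with h | h
  · rcases h' with h' | h'
    · exact L.meet a b c d h h' hne ⟨hw, hw'⟩
    · obtain rfl : c = d := h'
      obtain rfl : w = c := by simpa [chord_self] using hw'
      exact ⟨(eq_or_eq_of_coe_mem_chord hw).imp (congrArg _) (congrArg _), Or.inl rfl⟩
  · obtain rfl : a = b := h
    obtain rfl : w = a := by simpa [chord_self] using hw
    exact ⟨Or.inl rfl, (eq_or_eq_of_coe_mem_chord hw').imp (congrArg _) (congrArg _)⟩

/-- A chord with endpoints on different sides of a line crosses the line. -/
theorem exists_mem_chord_arcSide_eq_zero {α β : ℝ} {c d : Circle} (hc : 0 < arcSide α β c)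
    (hd : arcSide α β d < 0) : ∃ w ∈ chord c d, arcSide α β w = 0 := by
  have := (isConnected_chord c d).2.intermediate_value (right_mem_chord c d) (left_mem_chord c d)
    (continuous_arcSide_right α β).continuousOn
  exact this ⟨hd.le, hc.le⟩

theorem not_crossing {L : GeometricLamination} {α β : ℝ} (h₁ : α ≤ β) (h₂ : β ≤ α + 2 * Real.pi)
    (h : (Circle.exp α, Circle.exp β) ∈ L.fullLeaves) {c d : Circle} (h' : (c, d) ∈ L.fullLeaves)
    (hc : 0 < arcSide α β c) (hd : arcSide α β d < 0) : False := by
  obtain ⟨w, hw, h0⟩ := exists_mem_chord_arcSide_eq_zero hc hd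
  have hw' := mem_chord_of_arcSide_eq_zero h₁ h₂ (chord_subset_closedBall c d hw) h0
  have hne : s(Circle.exp α, Circle.exp β) ≠ s(c, d) := by
    intro he
    rcases Sym2.eq_iff.1 he with ⟨rfl, -⟩ | ⟨rfl, -⟩
    · exact hc.ne' (arcSide_exp_left α β)
    · exact hd.ne (arcSide_exp_left α β)
  rcases (meet_fullLeaves h h' hne hw' hw).2 with rfl | rfl
  · exact hc.ne' h0
  · exact hd.ne h0

/-- Two leaves do not have linked endpoints. -/
theorem not_linked {L : GeometricLamination} {α β γ δ : ℝ} (h₁ : α < β) (h₂ : β < γ) (h₃ : γ < δ)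
    (h₄ : δ < α + 2 * Real.pi) (h : (Circle.exp α, Circle.exp γ) ∈ L.fullLeaves)
    (h' : (Circle.exp β, Circle.exp δ) ∈ L.fullLeaves) : False :=
  not_crossing (by linarith) (by linarith) h h' (arcSide_exp_pos h₁ h₂ (by linarith))
    (arcSide_exp_neg (by linarith) h₃ h₄)

/-- A point of `L.star` on a chord is an endpoint of the chord, or the chord is a leaf, or the
point lies on a leaf that crosses the chord. -/
theorem cases_of_mem_star_of_arcSide_eq_zero {L : GeometricLamination} {α β : ℝ} (h₁ : α ≤ β)
    (h₂ : β ≤ α + 2 * Real.pi) {w : ℂ} (hw : w ∈ L.star) (h0 : arcSide α β w = 0) :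
    w = Circle.exp α ∨ w = Circle.exp β ∨ ∃ c d, (c, d) ∈ L.leaves ∧ w ∈ chord c d ∧
      ((c = Circle.exp α ∧ d = Circle.exp β) ∨ (arcSide α β c < 0 ∧ 0 < arcSide α β d)) := by
  have hwb := L.star_subset_closedBall hw
  have hend : ∀ z : Circle, arcSide α β z = 0 → z = Circle.exp α ∨ z = Circle.exp β :=
    fun z hz => eq_or_eq_of_coe_mem_chord (mem_chord_of_arcSide_eq_zero h₁ h₂
      (Metric.sphere_subset_closedBall z.coe_mem_sphere) hz)
  by_cases hs : w ∈ Metric.sphere (0 : ℂ) 1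
  · obtain ⟨z, rfl⟩ := exists_coe_circle hs
    rcases hend z h0 with rfl | rfl <;> simp
  -- inside the disk the point is an interior point of a leaf, on which `arcSide` is affine
  right; right
  obtain ⟨a, b, hab, hwab⟩ := exists_mem_chord hw
  have hne : a ≠ b := by
    rintro rfl
    rw [chord_self] at hwab
    obtain rfl : w = a := hwab
    exact hs a.coe_mem_sphere
  have hl := mem_leaves_of_ne hab hne
  have hl' := L.symm _ _ hl
  have hwba : w ∈ chord b a := chord_comm a b ▸ hwab
  have hwab' := hwab
  obtain ⟨t, s, ht, hs', hts, rfl⟩ := hwab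
  have ht' : 0 < t := by
    refine lt_of_le_of_ne ht fun h => hs ?_
    obtain rfl : s = 1 := by linarith
    simp [← h, Circle.norm_coe]
  have hs'' : 0 < s := by
    refine lt_of_le_of_ne hs' fun h => hs ?_
    obtain rfl : t = 1 := by linarith
    simp [← h, Circle.norm_coe]
  rw [arcSide_add_smul α β t s hts] at h0
  rcases lt_trichotomy (arcSide α β a) 0 with ha | ha | ha
  · exact ⟨a, b, hl, hwab', Or.inr ⟨ha, by nlinarith⟩⟩
  · have hb : arcSide α β b = 0 := by
      rw [ha, mul_zero, zero_add] at h0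
      exact (mul_eq_zero.1 h0).resolve_left hs''.ne'
    rcases hend a ha with ha | ha <;> rcases hend b hb with hb | hb
    · exact absurd (ha.trans hb.symm) hne
    · exact ⟨a, b, hl, hwab', Or.inl ⟨ha, hb⟩⟩
    · exact ⟨b, a, hl', hwba, Or.inl ⟨hb, ha⟩⟩
    · exact absurd (ha.trans hb.symm) hne
  · exact ⟨b, a, hl', hwba, Or.inr ⟨by nlinarith, ha⟩⟩

/-! ### The relation `sim` -/

theorem isOmegaContinuum_chord {L : GeometricLamination} {a b : Circle}
    (h : (a, b) ∈ L.fullLeaves) : L.IsOmegaContinuum (chord a b) where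
  subset_star := chord_subset_star h
  isCompact := isCompact_chord a b
  isConnected := isConnected_chord a b
  countable := (Set.toFinite {(a : ℂ), (b : ℂ)}).countable.mono (chord_inter_sphere a b)

theorem IsOmegaContinuum.union {L : GeometricLamination} {K K' : Set ℂ}
    (h : L.IsOmegaContinuum K) (h' : L.IsOmegaContinuum K') (hne : (K ∩ K').Nonempty) :
    L.IsOmegaContinuum (K ∪ K') where
  subset_star := union_subset h.subset_star h'.subset_star
  isCompact := h.isCompact.union h'.isCompact
  isConnected := h.isConnected.union hne h'.isConnected
  countable := by
    rw [union_inter_distrib_right]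
    exact h.countable.union h'.countable

/-- A closed connected nonempty part of an omega-continuum is one. -/
theorem IsOmegaContinuum.inter {L : GeometricLamination} {K F : Set ℂ}
    (h : L.IsOmegaContinuum K) (hF : IsClosed F) (hc : IsConnected (K ∩ F)) :
    L.IsOmegaContinuum (K ∩ F) where
  subset_star := inter_subset_left.trans h.subset_star
  isCompact := h.isCompact.inter_right hF
  isConnected := hc
  countable := h.countable.mono (inter_subset_inter_left _ inter_subset_left)

theorem sim_of_mem_fullLeaves {L : GeometricLamination} {a b : Circle}
    (h : (a, b) ∈ L.fullLeaves) : L.sim a b :=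
  ⟨chord a b, isOmegaContinuum_chord h, left_mem_chord a b, right_mem_chord a b⟩

theorem compatible_sim (L : GeometricLamination) : L.Compatible L.sim :=
  fun _ _ h => sim_of_mem_fullLeaves (Or.inl h)

theorem equivalence_sim (L : GeometricLamination) : Equivalence L.sim where
  refl a := sim_of_mem_fullLeaves (L.mem_fullLeaves_self a)
  symm := fun ⟨K, hK, hx, hy⟩ => ⟨K, hK, hy, hx⟩
  trans := fun ⟨K, hK, hx, hy⟩ ⟨K', hK', hy', hz⟩ =>
    ⟨K ∪ K', hK.union hK' ⟨_, hy, hy'⟩, Or.inl hx, Or.inr hz⟩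

/-- If a leaf meets an omega-continuum, then its endpoints are related to the points of the
omega-continuum: the leaf can be added to the omega-continuum. -/
theorem IsOmegaContinuum.sim_of_mem_chord {L : GeometricLamination} {K : Set ℂ}
    (hK : L.IsOmegaContinuum K) {x : Circle} (hx : (x : ℂ) ∈ K) {w : ℂ} (hw : w ∈ K)
    {a b : Circle} (h : (a, b) ∈ L.fullLeaves) (hwc : w ∈ chord a b) :
    L.sim x a ∧ L.sim x b :=
  have hU := hK.union (isOmegaContinuum_chord h) ⟨w, hw, hwc⟩
  ⟨⟨_, hU, Or.inl hx, Or.inr (left_mem_chord a b)⟩,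
    ⟨_, hU, Or.inl hx, Or.inr (right_mem_chord a b)⟩⟩

/-- Two related points on different sides of a chord are related to one of the endpoints of the
chord, or to the endpoints of a leaf that crosses it: an omega-continuum which contains the two
points has to cross the chord, and every point of the open disk in it lies on a leaf. -/
theorem sim_cases_of_arcSide {L : GeometricLamination} {α β : ℝ} (h₁ : α ≤ β)
    (h₂ : β ≤ α + 2 * Real.pi) {x y : Circle} (hxy : L.sim x y) (hx : arcSide α β x < 0)
    (hy : 0 < arcSide α β y) :
    L.sim x (Circle.exp α) ∨ L.sim x (Circle.exp β) ∨ ∃ c d, (c, d) ∈ L.leaves ∧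
      L.sim x c ∧ L.sim x d ∧ arcSide α β c < 0 ∧ 0 < arcSide α β d := by
  obtain ⟨K, hK, hxK, hyK⟩ := hxy
  obtain ⟨w, hw, h0⟩ := hK.isConnected.2.intermediate_value hxK hyK
    (continuous_arcSide_right α β).continuousOn ⟨hx.le, hy.le⟩
  rcases cases_of_mem_star_of_arcSide_eq_zero h₁ h₂ (hK.subset_star hw) h0 with
    rfl | rfl | ⟨c, d, hcd, hwc, h⟩
  · exact Or.inl ⟨K, hK, hxK, hw⟩
  · exact Or.inr (Or.inl ⟨K, hK, hxK, hw⟩)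
  · obtain ⟨hc, hd⟩ := hK.sim_of_mem_chord hxK hw (Or.inl hcd) hwc
    rcases h with ⟨rfl, rfl⟩ | ⟨h, h'⟩
    · exact Or.inl hc
    · exact Or.inr (Or.inr ⟨c, d, hcd, hc, hd, h, h'⟩)

/-- Linked pairs of related points are related to each other. -/
theorem sim_of_linked {L : GeometricLamination} {α β γ δ : ℝ} (h₁ : α < β) (h₂ : β < γ)
    (h₃ : γ < δ) (h₄ : δ < α + 2 * Real.pi) (h : L.sim (Circle.exp α) (Circle.exp γ))
    (h' : L.sim (Circle.exp β) (Circle.exp δ)) : L.sim (Circle.exp α) (Circle.exp β) := by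
  have E := L.equivalence_sim
  rcases sim_cases_of_arcSide (by linarith) (by linarith) (E.symm h')
    (arcSide_exp_neg (by linarith) h₃ h₄) (arcSide_exp_pos h₁ h₂ (by linarith)) with
    h5 | h5 | ⟨c, d, hcd, hc, hd, hc0, hd0⟩
  · exact E.symm (E.trans h' h5)
  · exact E.trans h (E.symm (E.trans h' h5))
  · -- a leaf `(c, d)` crosses the chord from `α` to `γ`
    obtain ⟨s, hs₁, hs₂, rfl⟩ := exists_exp_of_arcSide_neg (by linarith) hc0
    obtain ⟨t, ht₁, ht₂, rfl⟩ := exists_exp_of_arcSide_pos (by linarith) hd0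
    rw [← Circle.exp_add_two_pi α] at h
    rcases sim_cases_of_arcSide (α := t) (β := s) (by linarith) (by linarith) h
      (arcSide_exp_neg (by linarith) (by linarith) (by linarith))
      (arcSide_exp_pos ht₂ hs₁ (by linarith)) with h5 | h5 | ⟨c, d, hcd', -, -, hc1, hd1⟩
    · rw [Circle.exp_add_two_pi] at h5
      exact E.trans h5 (E.symm (E.trans h' hd))
    · rw [Circle.exp_add_two_pi] at h5
      exact E.trans h5 (E.symm (E.trans h' hc))
    · exact (not_crossing (by linarith) (by linarith) (Or.inl (L.symm _ _ hcd))
        (Or.inl (L.symm _ _ hcd')) hd1 hc1).elim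

/-- A sequence of omega-continua, each of which meets the next one, can be joined to an
omega-continuum together with an omega-continuum that contains all limit points. -/
theorem IsOmegaContinuum.union_iUnion {L : GeometricLamination} {M : ℕ → Set ℂ} {N : Set ℂ}
    (hM : ∀ n, L.IsOmegaContinuum (M n)) (hmeet : ∀ n, (M n ∩ M (n + 1)).Nonempty)
    (hN : L.IsOmegaContinuum N)
    (hlim : ∀ (k : ℕ → ℕ) (p : ℕ → ℂ) (w : ℂ), Tendsto k atTop atTop → (∀ j, p j ∈ M (k j)) →
      Tendsto p atTop (𝓝 w) → w ∈ N) :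
    L.IsOmegaContinuum (N ∪ ⋃ n, M n) := by
  have hsub : ⋃ n, M n ⊆ L.star := iUnion_subset fun n => (hM n).subset_star
  have hcl : closure (⋃ n, M n) ⊆ N ∪ ⋃ n, M n := by
    intro w hw
    by_contra hcon
    obtain ⟨p, hp, hpw⟩ := mem_closure_iff_seq_limit.1 hw
    choose k hk using fun j => mem_iUnion.1 (hp j)
    -- infinitely many `p j` lie in the same `M n`, or else `k` has a subsequence to infinity
    by_cases hk' : Tendsto k atTop atTop
    · exact hcon (Or.inl (hlim k p w hk' hk hpw))
    · obtain ⟨B, hB⟩ : ∃ B, ∃ᶠ j in atTop, k j < B := by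
        by_contra! hB
        exact hk' (tendsto_atTop.2 fun B => by simpa using hB B)
      have hcB : IsClosed (⋃ n ∈ Finset.range B, M n) :=
        isClosed_biUnion_finset fun n _ => (hM n).isCompact.isClosed
      have hwB : w ∈ ⋃ n ∈ Finset.range B, M n := by
        apply hcB.mem_of_frequently_of_tendsto _ hpw
        refine hB.mono fun j hj => ?_
        exact mem_biUnion (Finset.mem_coe.2 (Finset.mem_range.2 hj)) (hk j)
      simp only [mem_iUnion] at hwB
      obtain ⟨n, -, hn⟩ := hwB
      exact hcon (Or.inr (mem_iUnion.2 ⟨n, hn⟩))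
  have hconn : IsConnected (⋃ n, M n) :=
    IsConnected.iUnion_of_chain (fun n => (hM n).isConnected) fun n => hmeet n
  have heq : N ∪ ⋃ n, M n = N ∪ closure (⋃ n, M n) :=
    Subset.antisymm (union_subset_union_right _ subset_closure) (union_subset subset_union_left hcl)
  have hcb : ⋃ n, M n ⊆ Metric.closedBall (0 : ℂ) 1 := hsub.trans L.star_subset_closedBall
  have hclc : IsCompact (closure (⋃ n, M n)) :=
    (isCompact_closedBall (0 : ℂ) 1).of_isClosed_subset isClosed_closure
      (closure_minimal hcb Metric.isClosed_closedBall)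
  have hne : (N ∩ closure (⋃ n, M n)).Nonempty := by
    choose p hp using fun n => (hM n).isConnected.1
    obtain ⟨w, -, φ, hφ, hw⟩ := (isCompact_closedBall (0 : ℂ) 1).tendsto_subseq
      fun n => hcb (mem_iUnion.2 ⟨n, hp n⟩)
    exact ⟨w, hlim φ _ w hφ.tendsto_atTop (fun j => hp (φ j)) hw,
      mem_closure_of_tendsto hw (Eventually.of_forall fun j => mem_iUnion.2 ⟨_, hp (φ j)⟩)⟩
  exact
    { subset_star := union_subset hN.subset_star hsub
      isCompact := heq ▸ hN.isCompact.union hclc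
      isConnected := heq ▸ hN.isConnected.union hne hconn.closure
      countable := by
        rw [union_inter_distrib_right, iUnion_inter]
        exact hN.countable.union (countable_iUnion fun n => (hM n).countable) }

/-! ### Classes of `sim` are closed -/

/-- `L.Over c x t α β` says that the leaf from `exp (i α)` to `exp (i β)` joins points related to
`c` and separates `exp (i t)` from `exp (i x)`; here `(x - 2π, x)` parametrizes the circle
without the point `exp (i x)`. -/
structure Over (L : GeometricLamination) (c : Circle) (x t α β : ℝ) : Prop where
  left : x - 2 * Real.pi < α
  lt : α < t
  gt : t < β
  right : β < x
  mem : (Circle.exp α, Circle.exp β) ∈ L.leaves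
  sim : L.sim c (Circle.exp α)

theorem Over.sim_right {L : GeometricLamination} {c : Circle} {x t α β : ℝ}
    (h : L.Over c x t α β) : L.sim c (Circle.exp β) :=
  L.equivalence_sim.trans h.sim (L.compatible_sim _ _ h.mem)

theorem mem_leaves_of_tendsto {L : GeometricLamination} {u v : ℕ → ℝ} {a b : ℝ}
    (hu : Tendsto u atTop (𝓝 a)) (hv : Tendsto v atTop (𝓝 b))
    (h : ∀ n, (Circle.exp (u n), Circle.exp (v n)) ∈ L.leaves) :
    (Circle.exp a, Circle.exp b) ∈ L.leaves :=
  L.isCompact.isClosed.mem_of_tendsto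
    (((Circle.exp.continuous.tendsto a).comp hu).prodMk_nhds
      ((Circle.exp.continuous.tendsto b).comp hv)) (Eventually.of_forall h)

theorem tendsto_arcSide {u v : ℕ → ℝ} {p : ℕ → ℂ} {a b : ℝ} {w : ℂ}
    (hu : Tendsto u atTop (𝓝 a)) (hv : Tendsto v atTop (𝓝 b)) (hp : Tendsto p atTop (𝓝 w)) :
    Tendsto (fun n => arcSide (u n) (v n) (p n)) atTop (𝓝 (arcSide a b w)) :=
  (continuous_arcSide.tendsto (a, b, w)).comp (hu.prodMk_nhds (hv.prodMk_nhds hp))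

theorem arcSide_self_nonpos (α : ℝ) {w : ℂ} (hw : w ∈ Metric.closedBall (0 : ℂ) 1) :
    arcSide α α w ≤ 0 := by
  have h1 : ‖w‖ ≤ 1 := by simpa using hw
  have h2 : ‖w‖ ^ 2 ≤ 1 := by nlinarith [norm_nonneg w]
  rw [← Complex.normSq_eq_norm_sq, Complex.normSq_apply] at h2
  have h3 := Real.sin_sq_add_cos_sq α
  rw [arcSide, sub_self, zero_div, Real.cos_zero, add_self_div_two]
  nlinarith [sq_nonneg (w.re - Real.cos α), sq_nonneg (w.im - Real.sin α)]

/-- If leaves over a fixed point have right ends which accumulate at `x`, then these leaves are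
nested and converge to a leaf at `exp (i x)`. Parts of omega-continua between consecutive leaves
accumulate only on the limit leaf. -/
theorem sim_of_nested_leaves {L : GeometricLamination} {c : Circle} {x t : ℝ}
    (h : ∀ s < x, ∃ α β, L.Over c x t α β ∧ s < β) : L.sim c (Circle.exp x) := by
  have E := L.equivalence_sim
  set B : Set ℝ := {β | ∃ α, L.Over c x t α β} with hB
  have hlub : IsLUB B x := by
    refine ⟨fun β ⟨α, hα⟩ => hα.right.le, fun b hb => ?_⟩
    by_contra! hbx
    obtain ⟨α, β, hαβ, hs⟩ := h b hbx
    exact absurd (hb ⟨α, hαβ⟩) (not_le.2 hs)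
  obtain ⟨v, hv, hvx, hvl, hvB⟩ := hlub.exists_seq_strictMono_tendsto_of_notMem
    (fun ⟨α, hα⟩ => lt_irrefl _ hα.right)
    (by obtain ⟨α, β, hαβ, -⟩ := h (x - 1) (by linarith); exact ⟨β, α, hαβ⟩)
  choose u hu using hvB
  -- leaves over the same point do not cross, so they are nested
  have hua : Antitone u := by
    refine antitone_nat_of_succ_le fun n => ?_
    by_contra! hlt
    have h1 := hu n
    have h2 := hu (n + 1)
    exact not_linked hlt (h2.lt.trans h1.gt) (hv n.lt_succ_self)
      (by linarith [h1.left, h2.right]) (Or.inl h1.mem) (Or.inl h2.mem)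
  have hbdd : BddBelow (range u) := ⟨x - 2 * Real.pi, by rintro _ ⟨n, rfl⟩; exact (hu n).left.le⟩
  obtain ⟨a, hul⟩ : ∃ a, Tendsto u atTop (𝓝 a) := ⟨_, tendsto_atTop_ciInf hua hbdd⟩
  have ha1 : x - 2 * Real.pi ≤ a := ge_of_tendsto' hul fun n => (hu n).left.le
  have ha2 : a ≤ x := le_of_tendsto' hul fun n => by linarith [(hu n).lt, (hu n).gt, (hu n).right]
  have hleaf := mem_leaves_of_tendsto hul hvl fun n => (hu n).mem
  have hK : ∀ n, L.sim (Circle.exp (v n)) (Circle.exp (v (n + 1))) := fun n =>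
    E.trans (E.symm (hu n).sim_right) (hu (n + 1)).sim_right
  choose K hK hKv hKv' using hK
  set ℓ : ℕ → Set ℂ := fun n => chord (Circle.exp (u n)) (Circle.exp (v n)) with hℓ
  have hℓo : ∀ n, L.IsOmegaContinuum (ℓ n) := fun n => isOmegaContinuum_chord (Or.inl (hu n).mem)
  set Q : ℕ → Set ℂ := fun n => (ℓ n ∪ K n) ∪ ℓ (n + 1) with hQ
  have hQo : ∀ n, L.IsOmegaContinuum (Q n) := fun n =>
    ((hℓo n).union (hK n) ⟨_, right_mem_chord _ _, hKv n⟩).union (hℓo (n + 1))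
      ⟨_, Or.inr (hKv' n), right_mem_chord _ _⟩
  have huv : ∀ n, u n ≤ v n := fun n => ((hu n).lt.trans (hu n).gt).le
  have hvu : ∀ n, v n ≤ u n + 2 * Real.pi := fun n => by linarith [(hu n).left, hvx n]
  have hlevel : ∀ n w, w ∈ L.star → arcSide (u n) (v n) w = 0 → w ∈ ℓ n := fun n w hw h0 =>
    mem_chord_of_arcSide_eq_zero (huv n) (hvu n) (L.star_subset_closedBall hw) h0
  have hzero : ∀ n, ∀ w ∈ ℓ n, arcSide (u n) (v n) w = 0 := fun n w hw =>
    arcSide_eq_zero_of_mem_chord hw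
  have hout : ∀ n, ∀ w ∈ ℓ (n + 1), arcSide (u n) (v n) w ≤ 0 := by
    intro n w hw
    refine (convex_arcSide_nonpos (u n) (v n)).segment_subset ?_ ?_ hw
    · show arcSide (u n) (v n) _ ≤ 0
      rw [← Circle.exp_add_two_pi]
      exact arcSide_exp_nonpos (huv n) (by linarith [(hu (n + 1)).left, hvx n])
        (by linarith [hua n.le_succ])
    · exact arcSide_exp_nonpos (huv n) (hv n.lt_succ_self).le
        (by linarith [(hu n).left, hvx (n + 1)])
  -- the part of `Q n` between the leaves `ℓ n` and `ℓ (n + 1)`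
  set M : ℕ → Set ℂ := fun n => (Q n ∩ {w | arcSide (u n) (v n) w ≤ 0}) ∩
    {w | 0 ≤ arcSide (u (n + 1)) (v (n + 1)) w} with hMdef
  have hM : ∀ n, L.IsOmegaContinuum (M n) := by
    intro n
    have h1 : L.IsOmegaContinuum (Q n ∩ {w | arcSide (u n) (v n) w ≤ 0}) := by
      refine (hQo n).inter (isClosed_arcSide_nonpos _ _) ?_
      refine (hQo n).isConnected.inter_nonpos (hQo n).isCompact.isClosed
        (continuous_arcSide_right _ _) ?_
      have : Q n ∩ {w | arcSide (u n) (v n) w = 0} = ℓ n :=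
        Subset.antisymm (fun w hw => hlevel n w ((hQo n).subset_star hw.1) hw.2)
          fun w hw => ⟨Or.inl (Or.inl hw), hzero n w hw⟩
      rw [this]
      exact (hℓo n).isConnected
    refine h1.inter (isClosed_arcSide_nonneg _ _) ?_
    refine h1.isConnected.inter_nonneg h1.isCompact.isClosed (continuous_arcSide_right _ _) ?_
    have : (Q n ∩ {w | arcSide (u n) (v n) w ≤ 0}) ∩ {w | arcSide (u (n + 1)) (v (n + 1)) w = 0}
        = ℓ (n + 1) :=
      Subset.antisymm (fun w hw => hlevel (n + 1) w (h1.subset_star hw.1) hw.2)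
        fun w hw => ⟨⟨Or.inr hw, hout n w hw⟩, hzero (n + 1) w hw⟩
    rw [this]
    exact (hℓo (n + 1)).isConnected
  have hin : ∀ n, 0 ≤ arcSide (u (n + 1)) (v (n + 1)) (Circle.exp (v n)) := fun n =>
    arcSide_exp_nonneg ((hua n.le_succ).trans (huv n)) (hv n.lt_succ_self).le (hvu _)
  have hvM : ∀ n, ((Circle.exp (v n) : Circle) : ℂ) ∈ M n := fun n =>
    ⟨⟨Or.inl (Or.inl (right_mem_chord _ _)), (arcSide_exp_right _ _).le⟩, hin n⟩
  have hU := IsOmegaContinuum.union_iUnion hM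
    (fun n => ⟨_, ⟨⟨Or.inr (right_mem_chord _ _), hout n _ (right_mem_chord _ _)⟩,
      (arcSide_exp_right _ _).ge⟩, hvM (n + 1)⟩)
    (isOmegaContinuum_chord (Or.inl hleaf)) (by
      intro k p w hk hp hpw
      refine mem_chord_of_arcSide_eq_zero ha2 (by linarith) ?_ (le_antisymm ?_ ?_)
      · exact Metric.isClosed_closedBall.mem_of_tendsto hpw
          (Eventually.of_forall fun j => L.star_subset_closedBall ((hM (k j)).subset_star (hp j)))
      · exact le_of_tendsto' (tendsto_arcSide (hul.comp hk) (hvl.comp hk) hpw) fun j => (hp j).1.2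
      · have hk1 : Tendsto (fun j => k j + 1) atTop atTop := (tendsto_add_atTop_nat 1).comp hk
        exact ge_of_tendsto' (tendsto_arcSide (hul.comp hk1) (hvl.comp hk1) hpw)
          fun j => (hp j).2)
  exact E.trans (hu 0).sim_right
    ⟨_, hU, Or.inr (mem_iUnion.2 ⟨0, hvM 0⟩), Or.inl (right_mem_chord _ _)⟩

/-- If points of the class of `c` that are not under a leaf accumulate at `x`, then an
omega-continuum that joins two of them can be cut off at the first, and the resulting
omega-continua shrink to `exp (i x)`. -/
theorem sim_of_exposed_points {L : GeometricLamination} {c : Circle} {x : ℝ}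
    (h : ∀ s < x, ∃ e, s < e ∧ x - 2 * Real.pi < e ∧ e < x ∧ L.sim c (Circle.exp e) ∧
      ∀ α β, ¬ L.Over c x e α β) : L.sim c (Circle.exp x) := by
  by_contra hx
  have E := L.equivalence_sim
  set V : Set ℝ := {e | x - 2 * Real.pi < e ∧ e < x ∧ L.sim c (Circle.exp e) ∧
    ∀ α β, ¬ L.Over c x e α β} with hV
  have hlub : IsLUB V x := by
    refine ⟨fun e he => he.2.1.le, fun b hb => ?_⟩
    by_contra! hbx
    obtain ⟨e, hbe, he⟩ := h b hbx
    exact absurd (hb he) (not_le.2 hbe)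
  obtain ⟨v, hv, -, hvl, hvV⟩ := hlub.exists_seq_strictMono_tendsto_of_notMem
    (fun he => lt_irrefl _ he.2.1)
    (by obtain ⟨e, -, he⟩ := h (x - 1) (by linarith); exact ⟨e, he⟩)
  have hK : ∀ n, L.sim (Circle.exp (v n)) (Circle.exp (v (n + 1))) := fun n =>
    E.trans (E.symm (hvV n).2.2.1) (hvV (n + 1)).2.2.1
  choose K hK hKv hKv' using hK
  set M : ℕ → Set ℂ := fun n => K n ∩ {w | 0 ≤ arcSide (v n) x w} with hMdef
  have hM : ∀ n, L.IsOmegaContinuum (M n) := by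
    intro n
    obtain ⟨hn1, hn2, hn3, hn4⟩ := hvV n
    refine (hK n).inter (isClosed_arcSide_nonneg _ _) ?_
    refine (hK n).isConnected.inter_nonneg (hK n).isCompact.isClosed
      (continuous_arcSide_right _ _) ?_
    -- another point of `K n` on this chord would give a leaf over `v n`, or reach `exp (i x)`
    have : K n ∩ {w | arcSide (v n) x w = 0} = {((Circle.exp (v n) : Circle) : ℂ)} := by
      refine Subset.antisymm ?_ (singleton_subset_iff.2 ⟨hKv n, arcSide_exp_left _ _⟩)
      rintro w ⟨hw, h0⟩
      rcases cases_of_mem_star_of_arcSide_eq_zero hn2.le (by linarith) ((hK n).subset_star hw) h0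
        with h1 | rfl | ⟨a, b, hab, hwab, h1⟩
      · exact h1
      · exact absurd (E.trans hn3 ⟨K n, hK n, hKv n, hw⟩) hx
      · obtain ⟨ha, hb⟩ := (hK n).sim_of_mem_chord (hKv n) hw (Or.inl hab) hwab
        rcases h1 with ⟨-, rfl⟩ | ⟨h1, h2⟩
        · exact absurd (E.trans hn3 hb) hx
        · obtain ⟨γ, h3, h4, rfl⟩ := exists_exp_of_arcSide_neg (by linarith) h1
          obtain ⟨δ, h5, h6, rfl⟩ := exists_exp_of_arcSide_pos hn2.le h2
          rw [← Circle.exp_sub_two_pi γ] at hab ha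
          exact (hn4 (γ - 2 * Real.pi) δ
            ⟨by linarith, by linarith, h5, h6, hab, E.trans hn3 ha⟩).elim
    rw [this]
    exact isConnected_singleton
  have hvM : ∀ n, ((Circle.exp (v n) : Circle) : ℂ) ∈ M n := fun n =>
    ⟨hKv n, (arcSide_exp_left _ _).ge⟩
  have hU := IsOmegaContinuum.union_iUnion hM
    (fun n => ⟨_, ⟨hKv' n, arcSide_exp_nonneg (hv n.lt_succ_self).le (hvV _).2.1.le
      (by linarith [(hvV n).1])⟩, hvM (n + 1)⟩)
    (isOmegaContinuum_chord (L.mem_fullLeaves_self (Circle.exp x))) (by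
      intro k p w hk hp hpw
      have hw : w ∈ Metric.closedBall (0 : ℂ) 1 := Metric.isClosed_closedBall.mem_of_tendsto hpw
        (Eventually.of_forall fun j => L.star_subset_closedBall ((hM (k j)).subset_star (hp j)))
      refine mem_chord_of_arcSide_eq_zero le_rfl (by linarith [Real.pi_pos]) hw
        (le_antisymm (arcSide_self_nonpos x hw) ?_)
      exact ge_of_tendsto' (tendsto_arcSide (hvl.comp hk) tendsto_const_nhds hpw)
        fun j => (hp j).2)
  exact hx (E.trans (hvV 0).2.2.1
    ⟨_, hU, Or.inr (mem_iUnion.2 ⟨0, hvM 0⟩), Or.inl (right_mem_chord _ _)⟩)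

/-- A point at which a class accumulates from one side belongs to the class. -/
theorem sim_of_accumulates_below {L : GeometricLamination} {c : Circle} {x : ℝ}
    (h : ∀ s < x, ∃ γ, s < γ ∧ γ < x ∧ L.sim c (Circle.exp γ)) : L.sim c (Circle.exp x) := by
  have E := L.equivalence_sim
  by_cases hcase : ∃ t, ∀ s < x, ∃ α β, L.Over c x t α β ∧ s < β
  · obtain ⟨t, ht⟩ := hcase
    exact sim_of_nested_leaves ht
  push Not at hcase
  refine sim_of_exposed_points fun s hs => ?_
  obtain ⟨t, hst, htx, ht⟩ := h (max s (x - 2 * Real.pi)) (max_lt hs (by linarith [Real.pi_pos]))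
  obtain ⟨hst, hot⟩ := max_lt_iff.1 hst
  by_cases hex : ∃ α β, L.Over c x t α β
  swap
  · push Not at hex
    exact ⟨t, hst, hot, htx, ht, hex⟩
  -- the outermost leaf over `t` ends in an exposed point of the class
  obtain ⟨s', hs'x, hs'⟩ := hcase t
  set B : Set ℝ := {β | ∃ α, L.Over c x t α β} with hB
  have hBne : B.Nonempty := by obtain ⟨α, β, hαβ⟩ := hex; exact ⟨β, α, hαβ⟩
  have hBb : BddAbove B := ⟨s', by rintro β ⟨α, hα⟩; exact hs' α β hα⟩
  obtain ⟨v, -, hvl, hvB⟩ := exists_seq_tendsto_sSup hBne hBb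
  choose u hu using hvB
  obtain ⟨b, hb⟩ : ∃ b, b = sSup B := ⟨_, rfl⟩
  rw [← hb] at hvl
  have hle : ∀ β ∈ B, β ≤ b := fun β hβ => hb ▸ le_csSup hBb hβ
  obtain ⟨a, ⟨ha1, ha2⟩, φ, hφ, hul⟩ :=
    (isCompact_Icc (a := x - 2 * Real.pi) (b := t)).tendsto_subseq
      fun n => ⟨(hu n).left.le, (hu n).lt.le⟩
  have hleaf := mem_leaves_of_tendsto hul (hvl.comp hφ.tendsto_atTop) fun n => (hu (φ n)).mem
  have htb : t < b := (hu 0).gt.trans_le (hle _ ⟨_, hu 0⟩)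
  have hbx : b < x := (hb ▸ csSup_le hBne (by rintro β ⟨α, hα⟩; exact hs' α β hα)).trans_lt hs'x
  refine ⟨b, hst.trans htb, hot.trans htb, hbx, ?_, ?_⟩
  · -- the class has points under the leaf and beyond it, so it is linked with the leaf
    refine E.trans ?_ (L.compatible_sim _ _ hleaf)
    rcases ha2.eq_or_lt with rfl | ha2
    · exact ht
    · obtain ⟨c', hbc', hc'x, hc'⟩ := h b hbx
      exact E.trans ht (E.symm (sim_of_linked ha2 htb hbc' (by linarith)
        (L.compatible_sim _ _ hleaf) (E.trans (E.symm ht) hc')))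
  · intro α β hαβ
    rcases lt_or_ge a α with h1 | h1
    · exact not_linked h1 hαβ.lt hαβ.gt (by linarith [hαβ.right]) (Or.inl hleaf) (Or.inl hαβ.mem)
    rcases (h1.trans ha2).eq_or_lt with rfl | h2
    · exact not_linked (hu 0).lt (hu 0).gt ((hle _ ⟨_, hu 0⟩).trans_lt hαβ.gt)
        (by linarith [(hu 0).left, hαβ.right]) (Or.inl (hu 0).mem) (Or.inl hαβ.mem)
    · exact absurd (hle β ⟨α, hαβ.left, h2, htb.trans hαβ.gt, hαβ.right, hαβ.mem, hαβ.sim⟩)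
        (not_le.2 hαβ.gt)

theorem conj_mem_chord {a b : Circle} {w : ℂ} (h : w ∈ chord a b) :
    (starRingEnd ℂ) w ∈ chord a⁻¹ b⁻¹ := by
  obtain ⟨t, s, ht, hs, hts, rfl⟩ := h
  refine ⟨t, s, ht, hs, hts, ?_⟩
  simp [-Circle.coe_inv, Circle.coe_inv_eq_conj]

/-- The image of a geometric lamination under complex conjugation. -/
def reflect (L : GeometricLamination) : GeometricLamination where
  leaves := {p | (p.1⁻¹, p.2⁻¹) ∈ L.leaves}
  symm a b h := L.symm _ _ h
  isCompact := (L.isCompact.isClosed.preimage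
    ((continuous_fst.inv).prodMk (continuous_snd.inv))).isCompact
  meet a b c d h h' hne := by
    rintro w ⟨hw, hw'⟩
    have hne' : s(a⁻¹, b⁻¹) ≠ s(c⁻¹, d⁻¹) := by simpa using hne
    obtain ⟨h1, h2⟩ := L.meet _ _ _ _ h h' hne' ⟨conj_mem_chord hw, conj_mem_chord hw'⟩
    have key : ∀ z : Circle, (starRingEnd ℂ) w = (z⁻¹ : Circle) → w = z := fun z hz => by
      rw [Circle.coe_inv_eq_conj] at hz
      exact (starRingEnd ℂ).injective hz
    exact ⟨h1.imp (key a) (key b), h2.imp (key c) (key d)⟩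

theorem reflect_reflect (L : GeometricLamination) : L.reflect.reflect = L := by
  cases L
  simp [reflect]

theorem sim_reflect {L : GeometricLamination} {x y : Circle} (h : L.sim x y) :
    L.reflect.sim x⁻¹ y⁻¹ := by
  obtain ⟨K, hK, hx, hy⟩ := h
  refine ⟨(starRingEnd ℂ) '' K, ⟨?_, hK.isCompact.image Complex.continuous_conj,
    hK.isConnected.image _ Complex.continuous_conj.continuousOn,
    (hK.countable.image (starRingEnd ℂ)).mono ?_⟩, ⟨x, hx, ?_⟩, ⟨y, hy, ?_⟩⟩
  · rintro _ ⟨w, hw, rfl⟩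
    obtain ⟨a, b, hab, hwab⟩ := exists_mem_chord (hK.subset_star hw)
    refine chord_subset_star ?_ (conj_mem_chord hwab)
    rcases hab with hab | hab
    · exact Or.inl (by simpa [reflect] using hab)
    · obtain rfl : a = b := hab
      exact L.reflect.mem_fullLeaves_self _
  · rintro _ ⟨⟨w, hw, rfl⟩, hs⟩
    exact ⟨w, ⟨hw, by simpa using hs⟩, rfl⟩
  · exact (Circle.coe_inv_eq_conj x).symm
  · exact (Circle.coe_inv_eq_conj y).symm

theorem sim_of_mem_closure {L : GeometricLamination} {c x : Circle}
    (h : x ∈ closure {z | L.sim c z}) : L.sim c x := by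
  obtain ⟨x, rfl⟩ := Circle.exp_surjective x
  by_contra hx
  have h1 : ∃ s < x, ∀ γ, s < γ → γ < x → ¬ L.sim c (Circle.exp γ) := by
    by_contra! h1
    exact hx (sim_of_accumulates_below h1)
  have h2 : ∃ s > x, ∀ γ, x < γ → γ < s → ¬ L.sim c (Circle.exp γ) := by
    by_contra! h2
    -- complex conjugation interchanges the two sides of the point
    have : L.reflect.sim c⁻¹ (Circle.exp (-x)) := by
      refine sim_of_accumulates_below fun s hs => ?_
      obtain ⟨γ, h3, h4, h5⟩ := h2 (-s) (by linarith)
      refine ⟨-γ, by linarith, by linarith, ?_⟩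
      rw [Circle.exp_neg]
      exact sim_reflect h5
    have := sim_reflect this
    rw [reflect_reflect, Circle.exp_neg, inv_inv, inv_inv] at this
    exact hx this
  obtain ⟨s, hs, h1⟩ := h1
  obtain ⟨s', hs', h2⟩ := h2
  obtain ⟨z, ⟨γ, hγ, rfl⟩, hz⟩ := mem_closure_iff_nhds.1 h _
    (Circle.image_exp_mem_nhds (Ioo_mem_nhds hs hs'))
  rcases lt_trichotomy γ x with h3 | rfl | h3
  · exact h1 γ hγ.1 h3 hz
  · exact hx hz
  · exact h2 γ h3 hγ.2 hz

/-! ### The graph of `sim` is closed, and its classes are unlinked -/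

theorem eventually_exists_exp_mem {u : ℕ → Circle} {ξ r : ℝ} (hr : 0 < r)
    (hu : Tendsto u atTop (𝓝 (Circle.exp ξ))) :
    ∀ᶠ n in atTop, ∃ t, ξ - r < t ∧ t < ξ + r ∧ Circle.exp t = u n := by
  filter_upwards [hu (Circle.image_exp_mem_nhds (Ioo_mem_nhds (sub_lt_self ξ hr)
    (lt_add_of_pos_right ξ hr)))] with n ⟨t, ht, h⟩
  exact ⟨t, ht.1, ht.2, h⟩

/-- If three sequences of mutually related points converge to distinct points, then eventually all
their members are related: otherwise two classes contain interlaced triples of points. -/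
theorem exists_sim_of_tendsto_three {L : GeometricLamination} {u v w : ℕ → Circle}
    {x y z : Circle} (hu : Tendsto u atTop (𝓝 x)) (hv : Tendsto v atTop (𝓝 y))
    (hw : Tendsto w atTop (𝓝 z)) (hxy : x ≠ y) (hxz : x ≠ z) (hyz : y ≠ z)
    (huv : ∀ n, L.sim (u n) (v n)) (huw : ∀ n, L.sim (u n) (w n)) :
    ∃ N, ∀ m ≥ N, ∀ n ≥ N, L.sim (u m) (u n) := by
  have E := L.equivalence_sim
  obtain ⟨ξ, rfl⟩ := Circle.exp_surjective x
  obtain ⟨η, hη₁, hη₂, rfl⟩ := Circle.exists_exp_eq ξ y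
  obtain ⟨ζ, hζ₁, hζ₂, rfl⟩ := Circle.exists_exp_eq ξ z
  replace hη₁ : ξ < η := lt_of_le_of_ne hη₁ fun h => hxy (h ▸ rfl)
  replace hζ₁ : ξ < ζ := lt_of_le_of_ne hζ₁ fun h => hxz (h ▸ rfl)
  have hηζ : η ≠ ζ := fun h => hyz (h ▸ rfl)
  clear hxy hxz hyz
  wlog hlt : η < ζ generalizing η ζ v w
  · exact this huw huv ζ hζ₂ hw η hη₂ hv hζ₁ hη₁ hηζ.symm
      (lt_of_le_of_ne (not_lt.1 hlt) hηζ.symm)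
  -- neighbourhoods of radius `r` of the three points are disjoint and in the same cyclic order
  obtain ⟨r, hr, hr1, hr2, hr3⟩ : ∃ r : ℝ, 0 < r ∧ 2 * r < η - ξ ∧ 2 * r < ζ - η ∧
      2 * r < ξ + 2 * Real.pi - ζ := by
    refine ⟨min (η - ξ) (min (ζ - η) (ξ + 2 * Real.pi - ζ)) / 3, ?_, ?_, ?_, ?_⟩
    · have : 0 < min (η - ξ) (min (ζ - η) (ξ + 2 * Real.pi - ζ)) := by
        simp only [lt_min_iff]
        exact ⟨by linarith, by linarith, by linarith⟩
      linarith
    all_goals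
      have h1 := min_le_left (η - ξ) (min (ζ - η) (ξ + 2 * Real.pi - ζ))
      have h2 := min_le_right (η - ξ) (min (ζ - η) (ξ + 2 * Real.pi - ζ))
      have h3 := min_le_left (ζ - η) (ξ + 2 * Real.pi - ζ)
      have h4 := min_le_right (ζ - η) (ξ + 2 * Real.pi - ζ)
      linarith
  obtain ⟨N, hN⟩ := eventually_atTop.1 ((eventually_exists_exp_mem hr hu).and
    ((eventually_exists_exp_mem hr hv).and (eventually_exists_exp_mem hr hw)))
  refine ⟨N, fun m hm n hn => ?_⟩
  obtain ⟨⟨a, ha1, ha2, ha⟩, ⟨b, hb1, hb2, hb⟩, ⟨c, hc1, hc2, hc⟩⟩ := hN m hm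
  obtain ⟨⟨a', ha1', ha2', ha'⟩, ⟨b', hb1', hb2', hb'⟩, ⟨c', hc1', hc2', hc'⟩⟩ := hN n hn
  have hab : L.sim (Circle.exp a) (Circle.exp b) := ha ▸ hb ▸ huv m
  have hac : L.sim (Circle.exp a) (Circle.exp c) := ha ▸ hc ▸ huw m
  have hab' : L.sim (Circle.exp a') (Circle.exp b') := ha' ▸ hb' ▸ huv n
  have hac' : L.sim (Circle.exp a') (Circle.exp c') := ha' ▸ hc' ▸ huw n
  rw [← ha, ← ha']
  clear hN ha hb hc ha' hb' hc' hu hv hw huv huw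
  by_contra hcon
  wlog haa : a < a' generalizing a b c a' b' c'
  · refine this a' ha1' ha2' b' hb1' hb2' c' hc1' hc2' a ha1 ha2 b hb1 hb2 c hc1 hc2 hab' hac' hab
      hac (fun h => hcon (E.symm h)) (lt_of_le_of_ne (not_lt.1 haa) ?_)
    rintro rfl
    exact hcon (E.refl _)
  -- unlinked pairs of points from the three clusters reverse the order from cluster to cluster,
  -- which is impossible around a cycle of three
  have hbb : b' < b := by
    by_contra! h
    rcases h.eq_or_lt with rfl | h
    · exact hcon (E.trans hab (E.symm hab'))
    · exact hcon (sim_of_linked haa (by linarith) h (by linarith) hab hab')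
  have hcc : c' < c := by
    by_contra! h
    rcases h.eq_or_lt with rfl | h
    · exact hcon (E.trans hac (E.symm hac'))
    · exact hcon (sim_of_linked haa (by linarith) h (by linarith) hac hac')
  have := sim_of_linked hbb (by linarith : b < c') hcc (by linarith)
    (E.trans (E.symm hab') hac') (E.trans (E.symm hab) hac)
  exact hcon (E.trans hab (E.trans (E.symm this) (E.symm hab')))

theorem isClosed_sim (L : GeometricLamination) :
    IsClosed {p : Circle × Circle | L.sim p.1 p.2} := by
  have E := L.equivalence_sim
  rw [← isSeqClosed_iff_isClosed]
  rintro p ⟨x, y⟩ hp hlim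
  show L.sim x y
  by_contra hxy
  have hne : x ≠ y := by
    rintro rfl
    exact hxy (E.refl x)
  obtain ⟨hx, hy⟩ := Prod.tendsto_iff _ _ |>.1 hlim
  -- the points cannot eventually lie in one class, because classes are closed
  have hnot : ∀ φ : ℕ → ℕ, StrictMono φ →
      ¬ ∃ N, ∀ m ≥ N, ∀ n ≥ N, L.sim (p (φ m)).1 (p (φ n)).1 := by
    rintro φ hφ ⟨N, hN⟩
    have h1 : L.sim (p (φ N)).1 x := sim_of_mem_closure <|
      mem_closure_of_tendsto (hx.comp hφ.tendsto_atTop)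
        (eventually_atTop.2 ⟨N, fun n hn => hN N le_rfl n hn⟩)
    have h2 : L.sim (p (φ N)).1 y := sim_of_mem_closure <|
      mem_closure_of_tendsto (hy.comp hφ.tendsto_atTop)
        (eventually_atTop.2 ⟨N, fun n hn => E.trans (hN N le_rfl n hn) (hp (φ n))⟩)
    exact hxy (E.trans (E.symm h1) h2)
  -- the perpendicular bisector of the chord from `x` to `y`
  obtain ⟨f, hf⟩ : ∃ f : ℂ → ℝ, f = fun w =>
      w.re * ((y : ℂ).re - (x : ℂ).re) + w.im * ((y : ℂ).im - (x : ℂ).im) := ⟨_, rfl⟩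
  have hfc : Continuous f := by rw [hf]; fun_prop
  have hfl : ∀ (t s : ℝ) (z w : ℂ), f (t • z + s • w) = t * f z + s * f w := by
    intro t s z w
    simp [hf]
    ring
  have hn : ∀ z : Circle, (z : ℂ).re * (z : ℂ).re + (z : ℂ).im * (z : ℂ).im = 1 := fun z => by
    rw [← Complex.normSq_apply, Circle.normSq_coe]
  have hpos : 0 < ((y : ℂ).re - (x : ℂ).re) ^ 2 + ((y : ℂ).im - (x : ℂ).im) ^ 2 := by
    by_contra! h0
    apply hne
    apply Circle.ext
    apply Complex.ext <;> nlinarith [sq_nonneg ((y : ℂ).re - (x : ℂ).re),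
      sq_nonneg ((y : ℂ).im - (x : ℂ).im)]
  have hfx : f x < 0 := by
    simp only [hf]
    nlinarith [hn x, hn y]
  have hfy : 0 < f y := by
    simp only [hf]
    nlinarith [hn x, hn y]
  -- a leaf with related ends meets the bisector
  have hex : ∀ᶠ n in atTop, ∃ e : Circle × Circle, e ∈ L.fullLeaves ∧ L.sim (p n).1 e.1 ∧
      L.sim (p n).1 e.2 ∧ f e.1 * f e.2 ≤ 0 := by
    have hcoe : Continuous fun z : Circle => f z := hfc.comp continuous_subtype_val
    have h1 : ∀ᶠ n in atTop, f (p n).1 < 0 := ((hcoe.tendsto x).comp hx).eventually_lt_const hfx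
    have h2 : ∀ᶠ n in atTop, 0 < f (p n).2 := ((hcoe.tendsto y).comp hy).eventually_const_lt hfy
    filter_upwards [h1, h2] with n h1 h2
    obtain ⟨K, hK, hxK, hyK⟩ := hp n
    obtain ⟨w, hw, h0⟩ := hK.isConnected.2.intermediate_value hxK hyK hfc.continuousOn
      ⟨h1.le, h2.le⟩
    obtain ⟨a, b, hab, hwab⟩ := exists_mem_chord (hK.subset_star hw)
    obtain ⟨ha, hb⟩ := hK.sim_of_mem_chord hxK hw hab hwab
    refine ⟨(a, b), hab, ha, hb, ?_⟩
    obtain ⟨t, s, ht, hs, hts, rfl⟩ := hwab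
    rw [hfl] at h0
    show f a * f b ≤ 0
    by_contra! hab0
    rcases pos_and_pos_or_neg_and_neg_of_mul_pos hab0 with ⟨h3, h4⟩ | ⟨h3, h4⟩
    · rcases ht.eq_or_lt with rfl | ht
      · obtain rfl : s = 1 := by linarith
        linarith
      · nlinarith [mul_pos ht h3, mul_nonneg hs h4.le]
    · rcases ht.eq_or_lt with rfl | ht
      · obtain rfl : s = 1 := by linarith
        linarith
      · nlinarith [mul_neg_of_pos_of_neg ht h3, mul_nonpos_of_nonneg_of_nonpos hs h4.le]
  obtain ⟨N, hN⟩ := eventually_atTop.1 hex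
  choose! e he1 he2 he3 he4 using hN
  obtain ⟨⟨a, b⟩, hab, φ, hφ, hlim'⟩ := L.isCompact_fullLeaves.tendsto_subseq
    (x := fun n => e (n + N)) fun n => he1 _ (Nat.le_add_left N n)
  obtain ⟨ha, hb⟩ := Prod.tendsto_iff _ _ |>.1 hlim'
  have hφ' : StrictMono fun n => φ n + N := fun m n h => Nat.add_lt_add_right (hφ h) N
  have hab0 : f a * f b ≤ 0 := by
    have hcoe : Continuous fun z : Circle => f z := hfc.comp continuous_subtype_val
    exact le_of_tendsto' (((hcoe.tendsto a).comp ha).mul ((hcoe.tendsto b).comp hb))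
      fun n => he4 _ (Nat.le_add_left N _)
  have hor : ∀ g : ℕ → Circle, ∀ z, Tendsto g atTop (𝓝 z) →
      (∀ n, L.sim (p (φ n + N)).1 (g n)) → z = x ∨ z = y := by
    intro g z hg hs
    by_contra! hz
    exact hnot _ hφ' (exists_sim_of_tendsto_three (hx.comp hφ'.tendsto_atTop)
      (hy.comp hφ'.tendsto_atTop) hg hne hz.1.symm hz.2.symm (fun n => hp _) hs)
  have hxleaf : (x, y) ∈ L.fullLeaves := by
    rcases hor _ a ha fun n => he2 _ (Nat.le_add_left N _) with rfl | rfl <;>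
    rcases hor _ b hb fun n => he3 _ (Nat.le_add_left N _) with rfl | rfl
    · nlinarith
    · exact hab
    · exact fullLeaves_symm hab
    · nlinarith
  exact hxy (sim_of_mem_fullLeaves hxleaf)

theorem isClosedEquivalence_sim (L : GeometricLamination) : IsClosedEquivalence L.sim :=
  ⟨L.equivalence_sim, L.isClosed_sim⟩

/-- The convex hulls of two classes are separated by the chord that joins the first and the last
point of one class, as seen from a point of the other. -/
theorem hasUnlinkedClasses_sim (L : GeometricLamination) : HasUnlinkedClasses L.sim := by
  have E := L.equivalence_sim
  intro x y hxy
  obtain ⟨β, rfl⟩ := Circle.exp_surjective y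
  set A : Set ℝ := {t | t ∈ Icc β (β + 2 * Real.pi) ∧ L.sim x (Circle.exp t)} with hA
  have hAc : IsCompact A := by
    refine isCompact_Icc.of_isClosed_subset (isClosed_Icc.inter ?_) inter_subset_left
    exact L.isClosed_sim.preimage (continuous_const.prodMk Circle.exp.continuous)
  have hAne : A.Nonempty := by
    obtain ⟨t, h1, h2, rfl⟩ := Circle.exists_exp_eq β x
    exact ⟨t, ⟨h1, h2.le⟩, E.refl _⟩
  obtain ⟨s, hsA, hs⟩ := hAc.exists_isLeast hAne
  obtain ⟨t, htA, ht⟩ := hAc.exists_isGreatest hAne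
  have hst : s ≤ t := hs htA
  have hβs : β < s := lt_of_le_of_ne hsA.1.1 fun h => hxy (h ▸ hsA.2)
  have htβ : t < β + 2 * Real.pi := lt_of_le_of_ne htA.1.2 fun h => hxy <| by
    have := htA.2
    rwa [h, Circle.exp_add_two_pi] at this
  have h1 : circleHull (relClass L.sim x) ⊆ {w | 0 ≤ arcSide s t w} := by
    refine convexHull_min ?_ (convex_arcSide_nonneg s t)
    rintro _ ⟨z, hz, rfl⟩
    obtain ⟨γ, h3, h4, rfl⟩ := Circle.exists_exp_eq β z
    have hγ : γ ∈ A := ⟨⟨h3, h4.le⟩, hz⟩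
    exact arcSide_exp_nonneg (hs hγ) (ht hγ) (by linarith)
  have h2 : circleHull (relClass L.sim (Circle.exp β)) ⊆ {w | arcSide s t w < 0} := by
    refine convexHull_min ?_ (convex_arcSide_neg s t)
    rintro _ ⟨z, hz, rfl⟩
    obtain ⟨γ, h3, h4, rfl⟩ := Circle.exists_exp_eq β z
    have hz : L.sim (Circle.exp β) (Circle.exp γ) := hz
    have hxγ : ¬ L.sim x (Circle.exp γ) := fun h => hxy (E.trans h (E.symm hz))
    show arcSide s t (Circle.exp γ) < 0
    rcases lt_trichotomy γ s with h5 | rfl | h5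
    · rw [← Circle.exp_add_two_pi]
      exact arcSide_exp_neg hst (by linarith) (by linarith)
    · exact absurd hsA.2 hxγ
    rcases lt_trichotomy γ t with h6 | rfl | h6
    · refine absurd (E.trans hsA.2 ?_) hxγ
      refine sim_of_linked h5 h6 htβ (by linarith) (E.trans (E.symm hsA.2) htA.2) ?_
      rw [Circle.exp_add_two_pi]
      exact E.symm hz
    · exact absurd htA.2 hxγ
    · exact arcSide_exp_neg hst h6 (by linarith)
  refine disjoint_left.2 fun w hw hw' => ?_
  have h3 : 0 ≤ arcSide s t w := h1 hw
  have h4 : arcSide s t w < 0 := h2 hw'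
  exact h4.not_ge h3

end GeometricLamination

/-! ### Continuous functions separate the classes of a closed equivalence relation -/

/-- The quotient of a compact Hausdorff space by a closed equivalence relation is normal, so that
Urysohn's lemma applies to it. -/
theorem exists_continuous_separating {X : Type*} [TopologicalSpace X] [CompactSpace X] [T2Space X]
    {r : X → X → Prop} (hr : Equivalence r) (hc : IsClosed {p : X × X | r p.1 p.2}) {x y : X}
    (hxy : ¬ r x y) :
    ∃ g : X → ℝ, Continuous g ∧ (∀ a b, r a b → g a = g b) ∧ g x = 0 ∧ g y = 1 := by
  let S : Setoid X := ⟨r, hr⟩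
  let π : X → Quotient S := Quotient.mk S
  have hπ : IsQuotientMap π := isQuotientMap_quotient_mk'
  have hπr : ∀ a b, π a = π b ↔ r a b := fun a b => Quotient.eq (r := S)
  have hcl : IsClosedMap π := by
    intro F hF
    rw [← hπ.isClosed_preimage]
    have : π ⁻¹' (π '' F) = Prod.snd '' ({p : X × X | r p.1 p.2} ∩ (F ×ˢ univ)) := by
      ext b
      constructor
      · rintro ⟨a, ha, hab⟩
        exact ⟨(a, b), ⟨(hπr a b).1 hab, ha, trivial⟩, rfl⟩
      · rintro ⟨⟨a, b'⟩, ⟨hab, ha, -⟩, rfl⟩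
        exact ⟨a, ha, (hπr a b').2 hab⟩
    rw [this]
    exact ((hc.inter (hF.prod isClosed_univ)).isCompact.image continuous_snd).isClosed
  have hnormal : NormalSpace (Quotient S) := by
    refine ⟨fun A B hA hB hAB => ?_⟩
    obtain ⟨U, V, hU, hV, hAU, hBV, hUV⟩ := normal_separation (hA.preimage hπ.continuous)
      (hB.preimage hπ.continuous) (hAB.preimage π)
    refine ⟨kernImage π U, kernImage π V, isClosedMap_iff_kernImage.1 hcl hU,
      isClosedMap_iff_kernImage.1 hcl hV, subset_kernImage_iff.2 hAU, subset_kernImage_iff.2 hBV,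
      ?_⟩
    rw [disjoint_left]
    intro q hqU hqV
    obtain ⟨a, rfl⟩ := hπ.surjective q
    exact disjoint_left.1 hUV (hqU rfl) (hqV rfl)
  have hpt : ∀ a, IsClosed {π a} := fun a => by
    simpa using hcl {a} isClosed_singleton
  obtain ⟨f, hf0, hf1, -⟩ := exists_continuous_zero_one_of_isClosed (hpt x) (hpt y)
    (disjoint_singleton.2 fun h => hxy ((hπr x y).1 h))
  exact ⟨fun a => f (π a), f.continuous.comp hπ.continuous,
    fun a b hab => congrArg f ((hπr a b).2 hab), hf0 rfl, hf1 rfl⟩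

theorem isCompact_biUnion_chord {X : Type*} [TopologicalSpace X] {S : Set X} (hS : IsCompact S)
    {f g : X → Circle} (hf : Continuous f) (hg : Continuous g) :
    IsCompact (⋃ q ∈ S, chord (f q) (g q)) := by
  have : ⋃ q ∈ S, chord (f q) (g q) =
      (fun p : X × ℝ => (1 - p.2) • (f p.1 : ℂ) + p.2 • (g p.1 : ℂ)) '' (S ×ˢ Icc 0 1) := by
    ext w
    simp only [mem_iUnion, chord, segment_eq_image, mem_image, mem_prod, Prod.exists, exists_prop]
    constructor
    · rintro ⟨q, hq, t, ht, h⟩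
      exact ⟨q, t, ⟨hq, ht⟩, h⟩
    · rintro ⟨q, t, ⟨hq, ht⟩, h⟩
      exact ⟨q, hq, t, ht, h⟩
  rw [this]
  refine (hS.prod isCompact_Icc).image ?_
  have h1 : Continuous fun p : X × ℝ => (f p.1 : ℂ) :=
    continuous_subtype_val.comp (hf.comp continuous_fst)
  have h2 : Continuous fun p : X × ℝ => (g p.1 : ℂ) :=
    continuous_subtype_val.comp (hg.comp continuous_fst)
  fun_prop

namespace GeometricLamination

/-! ### Omega-continua and dense gaps -/

/-- The endpoint pairs, in the parametrization of the arc from `α` to `β`, of the leaves (and of the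
degenerate chords) with both ends in that arc. -/
def leavesIn (L : GeometricLamination) (α β : ℝ) : Set (ℝ × ℝ) :=
  {q | q ∈ Icc α β ×ˢ Icc α β ∧ q.1 ≤ q.2 ∧ (Circle.exp q.1, Circle.exp q.2) ∈ L.fullLeaves}

theorem isCompact_leavesIn (L : GeometricLamination) (α β : ℝ) : IsCompact (L.leavesIn α β) := by
  refine (isCompact_Icc.prod isCompact_Icc).of_isClosed_subset ?_ fun q hq => hq.1
  refine (isClosed_Icc.prod isClosed_Icc).inter
    ((isClosed_le continuous_fst continuous_snd).inter ?_)
  exact L.isCompact_fullLeaves.isClosed.preimage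
    ((Circle.exp.continuous.comp continuous_fst).prodMk (Circle.exp.continuous.comp continuous_snd))

theorem exists_mem_leavesIn {L : GeometricLamination} {α β : ℝ} (h₁ : α ≤ β)
    (h₂ : β ≤ α + 2 * Real.pi) (hab : (Circle.exp α, Circle.exp β) ∈ L.fullLeaves) {w : ℂ}
    (hw : w ∈ L.star) (hpos : 0 < arcSide α β w) :
    ∃ q ∈ L.leavesIn α β, w ∈ chord (Circle.exp q.1) (Circle.exp q.2) := by
  obtain ⟨c, d, hcd, hwcd⟩ := exists_mem_chord hw
  wlog hc : 0 < arcSide α β c generalizing c d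
  · refine this d c (fullLeaves_symm hcd) (chord_comm c d ▸ hwcd) ?_
    by_contra! hd
    exact hpos.not_ge ((convex_arcSide_nonpos α β).segment_subset (not_lt.1 hc) hd hwcd)
  have hd : 0 ≤ arcSide α β d := by
    by_contra! hd
    exact not_crossing h₁ h₂ hab hcd hc hd
  obtain ⟨γ, hγ₁, hγ₂, rfl⟩ := exists_exp_of_arcSide_nonneg h₁ hc.le
  obtain ⟨δ, hδ₁, hδ₂, rfl⟩ := exists_exp_of_arcSide_nonneg h₁ hd
  rcases le_total γ δ with h | h
  · exact ⟨(γ, δ), ⟨⟨⟨hγ₁, hγ₂⟩, hδ₁, hδ₂⟩, h, hcd⟩, hwcd⟩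
  · exact ⟨(δ, γ), ⟨⟨⟨hδ₁, hδ₂⟩, hγ₁, hγ₂⟩, h, fullLeaves_symm hcd⟩, chord_comm _ _ ▸ hwcd⟩

theorem eq_of_mem_leavesIn {L : GeometricLamination} {α β : ℝ} (h : β < α + 2 * Real.pi)
    {q q' : ℝ × ℝ} (hq : q ∈ L.leavesIn α β) (hq' : q' ∈ L.leavesIn α β)
    (he : s(Circle.exp q.1, Circle.exp q.2) = s(Circle.exp q'.1, Circle.exp q'.2)) : q = q' := by
  have hinj := Circle.exp_injOn_Icc (a := α) (b := β) (by linarith)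
  rcases Sym2.eq_iff.1 he with ⟨h1, h2⟩ | ⟨h1, h2⟩
  · exact Prod.ext (hinj hq.1.1 hq'.1.1 h1) (hinj hq.1.2 hq'.1.2 h2)
  · have h1 := hinj hq.1.1 hq'.1.2 h1
    have h2 := hinj hq.1.2 hq'.1.1 h2
    have := hq.2.1
    have := hq'.2.1
    exact Prod.ext (by linarith) (by linarith)

/-- Let `K` be a continuum in `L.star` which avoids the endpoints of a leaf and contains a point of
the circle. A point `p` near the midpoint of the leaf and not on `L.star` splits the leaves on its
side into those that separate it from the leaf and the others. If `p` is close enough, no leaf of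
the first kind has an endpoint in `K`, so the splitting disconnects `K` unless `K` misses
the leaf. -/
theorem not_mem_chord_of_arc {L : GeometricLamination} (hL : L.HasDenseGaps) {K : Set ℂ}
    (hKs : K ⊆ L.star) (hKc : IsClosed K) (hK : IsPreconnected K) {α ξ β : ℝ} (h₁ : α < ξ)
    (h₂ : ξ < β) (h₃ : β < α + 2 * Real.pi) (hab : (Circle.exp α, Circle.exp β) ∈ L.fullLeaves)
    (hξ : (Circle.exp ξ : ℂ) ∈ K) (hα : (Circle.exp α : ℂ) ∉ K) (hβ : (Circle.exp β : ℂ) ∉ K)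
    {w : ℂ} (hw : w ∈ K) (hwc : w ∈ chord (Circle.exp α) (Circle.exp β)) : False := by
  set C : ℝ × ℝ → Set ℂ := fun q => chord (Circle.exp q.1) (Circle.exp q.2) with hC
  have hcont : Continuous fun z : ℂ × (ℝ × ℝ) => arcSide z.2.1 z.2.2 z.1 :=
    continuous_arcSide.comp (by fun_prop : Continuous fun z : ℂ × (ℝ × ℝ) => (z.2.1, z.2.2, z.1))
  -- the leaves with an endpoint in `K`
  set Λ : Set (ℝ × ℝ) := L.leavesIn α β ∩
    ({q | (Circle.exp q.1 : ℂ) ∈ K} ∪ {q | (Circle.exp q.2 : ℂ) ∈ K}) with hΛ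
  have hexp : Continuous fun t : ℝ => (Circle.exp t : ℂ) :=
    continuous_subtype_val.comp Circle.exp.continuous
  have hΛc : IsCompact Λ := (L.isCompact_leavesIn α β).inter_right
    ((hKc.preimage (hexp.comp continuous_fst)).union (hKc.preimage (hexp.comp continuous_snd)))
  set m : ℂ := (1 / 2 : ℝ) • (Circle.exp α : ℂ) + (1 / 2 : ℝ) • (Circle.exp β : ℂ) with hm
  have hmΛ : ∀ q ∈ Λ, arcSide q.1 q.2 m < 0 := by
    rintro ⟨γ, δ⟩ ⟨⟨⟨⟨hγ₁, hγ₂⟩, hδ₁, hδ₂⟩, hγδ, -⟩, hqK⟩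
    simp only at hγ₁ hγ₂ hδ₁ hδ₂ hγδ
    rw [hm, arcSide_add_smul _ _ _ _ (by norm_num)]
    have h4 : arcSide γ δ (Circle.exp α) ≤ 0 := by
      rw [← Circle.exp_add_two_pi]
      exact arcSide_exp_nonpos hγδ (by linarith) (by linarith)
    have h5 : arcSide γ δ (Circle.exp β) ≤ 0 := arcSide_exp_nonpos hγδ hδ₂ (by linarith)
    rcases hγ₁.eq_or_lt with rfl | h6
    · have hδ : δ < β := by
        refine lt_of_le_of_ne hδ₂ ?_
        rintro rfl
        exact hqK.elim hα hβ
      have := arcSide_exp_neg hγδ hδ (by linarith)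
      linarith
    · have : arcSide γ δ (Circle.exp α) < 0 := by
        rw [← Circle.exp_add_two_pi]
        exact arcSide_exp_neg hγδ (by linarith) (by linarith)
      linarith
  have hev : ∀ᶠ p in 𝓝 m, ∀ q ∈ Λ, arcSide q.1 q.2 p < 0 :=
    hΛc.eventually_forall_of_forall_eventually fun q hq =>
      (hcont.tendsto (m, q)).eventually_lt_const (hmΛ q hq)
  -- a point of a gap near the midpoint of the leaf
  obtain ⟨p, hpΛ, hppos, hpball, hpstar⟩ : ∃ p, (∀ q ∈ Λ, arcSide q.1 q.2 p < 0) ∧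
      0 < arcSide α β p ∧ p ∈ Metric.ball (0 : ℂ) 1 ∧ p ∉ L.star := by
    obtain ⟨U, hU, hUo, hmU⟩ := eventually_nhds_iff.1 hev
    have hcb : ∀ z : Circle, (z : ℂ) ∈ Metric.closedBall (0 : ℂ) 1 := fun z =>
      Metric.sphere_subset_closedBall z.coe_mem_sphere
    have hne : (Circle.exp α : ℂ) ≠ Circle.exp β := fun h =>
      (h₁.trans h₂).ne (Circle.exp_injOn_Icc (a := α) (b := β) (by linarith)
        ⟨le_rfl, by linarith⟩ ⟨by linarith, le_rfl⟩ (Circle.ext h))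
    have hmb : m ∈ Metric.ball (0 : ℂ) 1 :=
      combo_mem_ball_of_ne (hcb _) (hcb _) hne (by norm_num) (by norm_num) (by norm_num)
    have hm0 : arcSide α β m = 0 := by
      rw [hm, arcSide_add_smul _ _ _ _ (by norm_num), arcSide_exp_left, arcSide_exp_right]
      norm_num
    have hmξ : m ≠ Circle.exp ξ := fun h => by
      rw [h] at hmb
      simp [-Circle.coe_exp, Circle.norm_coe] at hmb
    have hlim : Tendsto (fun ε : ℝ => (1 - ε) • m + ε • (Circle.exp ξ : ℂ)) (𝓝[>] 0) (𝓝 m) := by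
      have : Continuous fun ε : ℝ => (1 - ε) • m + ε • (Circle.exp ξ : ℂ) := by fun_prop
      have h := (this.tendsto 0).mono_left (nhdsWithin_le_nhds (s := Ioi 0))
      simpa [-Circle.coe_exp] using h
    obtain ⟨ε, hεU, hε0, hε1⟩ := ((hlim.eventually (hUo.mem_nhds hmU)).and
      (Ioo_mem_nhdsGT (zero_lt_one' ℝ))).exists
    have hopen : IsOpen (U ∩ {w | 0 < arcSide α β w}) :=
      hUo.inter (isOpen_lt continuous_const (continuous_arcSide_right α β))
    obtain ⟨p, ⟨hpU, hpp⟩, hpb, hps⟩ := mem_closure_iff.1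
      (hL (combo_mem_ball_of_ne (Metric.ball_subset_closedBall hmb) (hcb _) hmξ
        (sub_pos.2 hε1) hε0 (by ring))) _ hopen ⟨hεU, by
          show 0 < arcSide α β _
          rw [arcSide_add_smul _ _ _ _ (by ring), hm0]
          have := arcSide_exp_pos h₁ h₂ h₃.le
          nlinarith⟩
    exact ⟨p, hU p hpU, hpp, hpb, hps⟩
  have hp0 : ∀ q ∈ L.leavesIn α β, arcSide q.1 q.2 p ≠ 0 := fun q hq h0 =>
    hpstar (chord_subset_star hq.2.2 (mem_chord_of_arcSide_eq_zero hq.2.1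
      (by linarith [hq.1.1.1, hq.1.2.2]) (Metric.ball_subset_closedBall hpball) h0))
  have hpc : Continuous fun q : ℝ × ℝ => arcSide q.1 q.2 p :=
    hcont.comp (by fun_prop : Continuous fun q : ℝ × ℝ => (p, q))
  have hnear : IsCompact (⋃ q ∈ L.leavesIn α β ∩ {q | 0 ≤ arcSide q.1 q.2 p}, C q) :=
    isCompact_biUnion_chord
      ((L.isCompact_leavesIn α β).inter_right (isClosed_le continuous_const hpc))
      (Circle.exp.continuous.comp continuous_fst) (Circle.exp.continuous.comp continuous_snd)
  have hfar : IsCompact (⋃ q ∈ L.leavesIn α β ∩ {q | arcSide q.1 q.2 p ≤ 0}, C q) :=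
    isCompact_biUnion_chord
      ((L.isCompact_leavesIn α β).inter_right (isClosed_le hpc continuous_const))
      (Circle.exp.continuous.comp continuous_fst) (Circle.exp.continuous.comp continuous_snd)
  obtain ⟨z, hzK, hz1, hz2⟩ := isPreconnected_closed_iff.1 hK _ _
    ((isClosed_arcSide_nonpos α β).union hnear.isClosed) hfar.isClosed
    (by
      intro z hz
      rcases le_or_gt (arcSide α β z) 0 with h | h
      · exact Or.inl (Or.inl h)
      obtain ⟨q, hq, hzq⟩ := exists_mem_leavesIn (h₁.trans h₂).le h₃.le hab (hKs hz) h
      rcases le_total 0 (arcSide q.1 q.2 p) with h' | h'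
      · exact Or.inl (Or.inr (mem_biUnion (show q ∈ _ ∩ _ from ⟨hq, h'⟩) hzq))
      · exact Or.inr (mem_biUnion (show q ∈ _ ∩ _ from ⟨hq, h'⟩) hzq))
    ⟨w, hw, Or.inl (arcSide_eq_zero_of_mem_chord hwc).le⟩
    ⟨_, hξ, mem_biUnion (show (ξ, ξ) ∈ _ ∩ _ from
      ⟨⟨⟨⟨h₁.le, h₂.le⟩, h₁.le, h₂.le⟩, le_rfl, L.mem_fullLeaves_self _⟩,
        arcSide_self_nonpos ξ (Metric.ball_subset_closedBall hpball)⟩) (left_mem_chord _ _)⟩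
  obtain ⟨q, ⟨hq, hqp⟩, hzq⟩ := mem_iUnion₂.1 hz2
  have hqp : arcSide q.1 q.2 p < 0 := lt_of_le_of_ne hqp (hp0 q hq)
  have hαβ : ((α, β) : ℝ × ℝ) ∈ L.leavesIn α β :=
    ⟨⟨⟨le_rfl, (h₁.trans h₂).le⟩, (h₁.trans h₂).le, le_rfl⟩, (h₁.trans h₂).le, hab⟩
  rcases hz1 with hz1 | hz1
  · have hge : 0 ≤ arcSide α β z := (convex_arcSide_nonneg α β).segment_subset
      (arcSide_exp_nonneg hq.1.1.1 hq.1.1.2 h₃.le) (arcSide_exp_nonneg hq.1.2.1 hq.1.2.2 h₃.le) hzq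
    have hzc := mem_chord_of_arcSide_eq_zero (h₁.trans h₂).le h₃.le
      (L.star_subset_closedBall (hKs hzK)) (le_antisymm hz1 hge)
    by_cases he : s(Circle.exp q.1, Circle.exp q.2) = s(Circle.exp α, Circle.exp β)
    · rw [eq_of_mem_leavesIn h₃ hq hαβ he] at hqp
      exact hqp.not_gt hppos
    · rcases (meet_fullLeaves hq.2.2 hab he hzq hzc).2 with rfl | rfl
      · exact hα hzK
      · exact hβ hzK
  · obtain ⟨q', ⟨hq', hqp'⟩, hzq'⟩ := mem_iUnion₂.1 hz1
    have hqp' : 0 ≤ arcSide q'.1 q'.2 p := hqp'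
    by_cases he : s(Circle.exp q.1, Circle.exp q.2) = s(Circle.exp q'.1, Circle.exp q'.2)
    · rw [eq_of_mem_leavesIn h₃ hq hq' he] at hqp
      exact hqp.not_ge hqp'
    · have hz := (meet_fullLeaves hq.2.2 hq'.2.2 he hzq hzq').2
      have hqΛ : q' ∈ Λ := by
        refine ⟨hq', ?_⟩
        rcases hz with rfl | rfl
        · exact Or.inl hzK
        · exact Or.inr hzK
      exact (hpΛ q' hqΛ).not_ge hqp'

/-- If the gaps are dense, an omega-continuum with a point on the circle contains an endpoint of
every leaf that it meets. -/
theorem IsOmegaContinuum.endpoint_mem {L : GeometricLamination} (hL : L.HasDenseGaps) {K : Set ℂ}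
    (hK : L.IsOmegaContinuum K) {z : Circle} (hz : (z : ℂ) ∈ K) {a b : Circle}
    (hab : (a, b) ∈ L.fullLeaves) {w : ℂ} (hw : w ∈ K) (hwc : w ∈ chord a b) :
    (a : ℂ) ∈ K ∨ (b : ℂ) ∈ K := by
  by_contra! hcon
  obtain ⟨ha, hb⟩ := hcon
  obtain ⟨α, rfl⟩ := Circle.exp_surjective a
  obtain ⟨β, hβ₁, hβ₂, rfl⟩ := Circle.exists_exp_eq α b
  obtain ⟨ξ, hξ₁, hξ₂, rfl⟩ := Circle.exists_exp_eq α z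
  have hξα : α < ξ := lt_of_le_of_ne hξ₁ fun h => ha (h ▸ hz)
  rcases lt_trichotomy ξ β with h | rfl | h
  · exact not_mem_chord_of_arc hL hK.subset_star hK.isCompact.isClosed hK.isConnected.2 hξα h hβ₂
      hab hz ha hb hw hwc
  · exact hb hz
  · rcases hβ₁.eq_or_lt with rfl | hβ₁
    · rw [chord_self] at hwc
      obtain rfl : w = Circle.exp α := hwc
      exact ha hw
    · rw [← Circle.exp_add_two_pi α] at ha hab hwc
      exact not_mem_chord_of_arc hL hK.subset_star hK.isCompact.isClosed hK.isConnected.2 h hξ₂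
        (by linarith) (fullLeaves_symm hab) hz hb ha hw (chord_comm _ _ ▸ hwc)

/-- A compatible closed equivalence relation that separates two related points gives a continuous
function which is constant on leaves and takes every value between `0` and `1` on the countably many
points of an omega-continuum on the circle. -/
theorem sim_le_of_compatible {L : GeometricLamination} (hL : L.HasDenseGaps)
    {r : Circle → Circle → Prop} (hr : IsClosedEquivalence r) (hc : L.Compatible r) {x y : Circle}
    (h : L.sim x y) : r x y := by
  by_contra hxy
  obtain ⟨g, hg, hgr, hgx, hgy⟩ := exists_continuous_separating hr.equivalence hr.isClosed hxy
  have hgl : ∀ p ∈ L.fullLeaves, g p.1 = g p.2 := by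
    rintro ⟨a, b⟩ (h | h)
    · exact hgr _ _ (hc a b h)
    · exact congrArg g h
  obtain ⟨K, hK, hxK, hyK⟩ := h
  have hcount : (g '' {z : Circle | (z : ℂ) ∈ K}).Countable := by
    refine Countable.image ?_ g
    have hsub : {z : Circle | (z : ℂ) ∈ K} ⊆
        (fun z : Circle => (z : ℂ)) ⁻¹' (K ∩ Metric.sphere 0 1) :=
      fun z hz => ⟨hz, z.coe_mem_sphere⟩
    exact (hK.countable.preimage fun a b h => Circle.ext h).mono hsub
  have hsub : Icc (0 : ℝ) 1 ⊆ g '' {z : Circle | (z : ℂ) ∈ K} := by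
    rintro t ⟨ht0, ht1⟩
    have hle : IsCompact (⋃ p ∈ L.fullLeaves ∩ {p | g p.1 ≤ t}, chord p.1 p.2) :=
      isCompact_biUnion_chord (L.isCompact_fullLeaves.inter_right
        (isClosed_le (hg.comp continuous_fst) continuous_const)) continuous_fst continuous_snd
    have hge : IsCompact (⋃ p ∈ L.fullLeaves ∩ {p | t ≤ g p.1}, chord p.1 p.2) :=
      isCompact_biUnion_chord (L.isCompact_fullLeaves.inter_right
        (isClosed_le continuous_const (hg.comp continuous_fst))) continuous_fst continuous_snd
    obtain ⟨w, hwK, hw1, hw2⟩ := isPreconnected_closed_iff.1 hK.isConnected.2 _ _ hle.isClosed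
      hge.isClosed
      (by
        intro w hw
        obtain ⟨a, b, hab, hwab⟩ := exists_mem_chord (hK.subset_star hw)
        rcases le_total (g a) t with h | h
        · exact Or.inl (mem_biUnion (show (a, b) ∈ _ ∩ _ from ⟨hab, h⟩) hwab)
        · exact Or.inr (mem_biUnion (show (a, b) ∈ _ ∩ _ from ⟨hab, h⟩) hwab))
      ⟨x, hxK, mem_biUnion (show (x, x) ∈ _ ∩ _ from
        ⟨L.mem_fullLeaves_self x, hgx.le.trans ht0⟩) (left_mem_chord x x)⟩
      ⟨y, hyK, mem_biUnion (show (y, y) ∈ _ ∩ _ from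
        ⟨L.mem_fullLeaves_self y, ht1.trans hgy.ge⟩) (left_mem_chord y y)⟩
    obtain ⟨⟨a, b⟩, ⟨hab, hat⟩, hwab⟩ := mem_iUnion₂.1 hw1
    obtain ⟨⟨c, d⟩, ⟨hcd, hct⟩, hwcd⟩ := mem_iUnion₂.1 hw2
    have hgab : g a = g b := hgl _ hab
    have hgcd : g c = g d := hgl _ hcd
    have hgac : g a = g c := by
      by_cases he : s(a, b) = s(c, d)
      · rcases Sym2.eq_iff.1 he with ⟨rfl, -⟩ | ⟨rfl, -⟩
        · rfl
        · exact hgcd.symm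
      · obtain ⟨h1, h2⟩ := meet_fullLeaves hab hcd he hwab hwcd
        rcases h1 with rfl | rfl <;> rcases h2 with h2 | h2 <;>
          have := congrArg g (Circle.ext h2) <;> linarith
    have hgt : g a = t := le_antisymm hat (hgac ▸ hct)
    rcases hK.endpoint_mem hL hxK hab hwK hwab with h | h
    · exact ⟨a, h, hgt⟩
    · exact ⟨b, h, hgab ▸ hgt⟩
  -- a countable set has measure zero, but the unit interval does not
  have h0 := (hcount.mono hsub).measure_zero MeasureTheory.volume
  simp at h0

theorem isFinestCompatible_sim {L : GeometricLamination} (hL : L.HasDenseGaps) :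
    L.IsFinestCompatible L.sim :=
  ⟨L.isClosedEquivalence_sim, L.compatible_sim, fun _ hq hc _ _ h =>
    sim_le_of_compatible hL hq hc h⟩

/-! ### Invariant laminations -/

theorem sim_sq {L : GeometricLamination} (hL : L.HasDenseGaps) (hinv : L.IsInvariant)
    {x y : Circle} (h : L.sim x y) : L.sim (x ^ 2) (y ^ 2) := by
  have E := L.equivalence_sim
  refine sim_le_of_compatible hL (r := fun x y => L.sim (x ^ 2) (y ^ 2))
    ⟨⟨fun _ => E.refl _, fun h => E.symm h, fun h h' => E.trans h h'⟩, ?_⟩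
    (fun c d hcd => L.compatible_sim _ _ (hinv c d hcd).1) h
  exact L.isClosed_sim.preimage ((continuous_fst.pow 2).prodMk (continuous_snd.pow 2))

/-- A class with an interior point contains an arc, and an iterate of the doubling map sends the arc
onto the circle. -/
theorem isNowhereDense_or_isDegenerate {L : GeometricLamination} (hL : L.HasDenseGaps)
    (hinv : L.IsInvariant) : (∀ x, IsNowhereDense (relClass L.sim x)) ∨ IsDegenerate L.sim := by
  have E := L.equivalence_sim
  by_contra! hcon
  obtain ⟨⟨x, hx⟩, hdeg⟩ := hcon
  refine hdeg ?_
  have hcl : IsClosed (relClass L.sim x) :=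
    L.isClosed_sim.preimage (continuous_const.prodMk continuous_id)
  rw [IsNowhereDense, hcl.closure_eq, ← ne_eq, ← nonempty_iff_ne_empty] at hx
  obtain ⟨z, hz⟩ := hx
  obtain ⟨ζ, rfl⟩ := Circle.exp_surjective z
  have hnhds : Circle.exp ⁻¹' (relClass L.sim x) ∈ 𝓝 ζ :=
    Circle.exp.continuous.continuousAt (mem_interior_iff_mem_nhds.1 hz)
  obtain ⟨ε, hε, hball⟩ := Metric.mem_nhds_iff.1 hnhds
  obtain ⟨n, hn⟩ := pow_unbounded_of_one_lt (2 * Real.pi / ε) (one_lt_two : (1 : ℝ) < 2)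
  have hpow : ∀ k, ∀ a b, L.sim a b → L.sim (a ^ 2 ^ k) (b ^ 2 ^ k) := by
    intro k
    induction k with
    | zero => intro a b h; simpa using h
    | succ k ih =>
      intro a b h
      rw [pow_succ, pow_mul, pow_mul]
      exact sim_sq hL hinv (ih a b h)
  have h2n : (0 : ℝ) < 2 ^ n := by positivity
  have hall : ∀ y, L.sim (x ^ 2 ^ n) y := by
    intro y
    obtain ⟨γ, h1, h2, rfl⟩ := Circle.exists_exp_eq (2 ^ n * ζ) y
    have hγ : γ / 2 ^ n ∈ Metric.ball ζ ε := by
      have h3 : 2 * Real.pi < 2 ^ n * ε := (div_lt_iff₀ hε).1 hn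
      have h4 : ζ ≤ γ / 2 ^ n := by rw [le_div_iff₀ h2n]; linarith
      have h5 : γ / 2 ^ n < ζ + ε := by rw [div_lt_iff₀ h2n]; linarith
      rw [Metric.mem_ball, Real.dist_eq, abs_lt]
      exact ⟨by linarith, by linarith⟩
    have h6 := hpow n _ _ (hball hγ)
    rw [← Circle.exp_nsmul] at h6
    rw [show (2 ^ n : ℕ) • (γ / 2 ^ n) = γ by
      rw [nsmul_eq_mul]; push_cast; field_simp] at h6
    exact h6
  exact fun a b => E.trans (E.symm (hall a)) (hall b)

end GeometricLamination

theorem mainTheorem6 (L : GeometricLamination) (hL : L.HasDenseGaps) :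
    (IsClosedEquivalence L.sim ∧ HasUnlinkedClasses L.sim) ∧
    (L.IsFinestCompatible L.sim ∧ L.sim = L.closedRel) ∧
    ((L.IsInvariant ∨
        ∃ r : Circle → Circle → Prop, IsLamination r ∧ ¬ IsDegenerate r ∧ L.Compatible r) →
      IsLamination L.sim ∧ L.sim = L.laminationRel) := by
  have hfin := L.isFinestCompatible_sim hL
  refine ⟨⟨L.isClosedEquivalence_sim, L.hasUnlinkedClasses_sim⟩, ⟨hfin, ?_⟩, fun h => ?_⟩
  · ext x y
    exact ⟨fun h r hr hc => hfin.finest r hr hc x y h,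
      fun h => h _ hfin.closedEquivalence hfin.compatible⟩
  · have hlam : IsLamination L.sim := by
      refine ⟨L.isClosedEquivalence_sim, L.hasUnlinkedClasses_sim, ?_⟩
      rcases h with h | ⟨r, hr, hdeg, hc⟩
      · exact GeometricLamination.isNowhereDense_or_isDegenerate hL h
      · exact Or.inl fun x => (hr.nowhereDense.resolve_right hdeg x).mono
          fun y hy => hfin.finest r hr.closedEquivalence hc x y hy
    refine ⟨hlam, ?_⟩
    ext x y
    exact ⟨fun h r hr hc => hfin.finest r hr.closedEquivalence hc x y h,
      fun h => h _ hlam hfin.compatible⟩
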